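/- **Theorem (Morita).** Let $g,d\ge 1$. Let $\Sigma=\Sigma_g^1$ be a compact oriented surface of genus $g$ with one boundary component, let $*\in\partial\Sigma$, $\pi=\pi_1(\Sigma,*)$ and $H=H_1(\Sigma;\mathbb Q)=\pi^{\mathrm{ab}}\otimes\mathbb Q$, and let $\omega$ be the algebraic intersection form on $H$. Let $\mathrm{Mod}_g^1$ be the group of isotopy classes (rel $\partial\Sigma$) of homeomorphisms of $\Sigma$ fixing $\partial\Sigma$ pointwise; it acts on $\pi$. Put $\gamma_1(\pi)=\pi$, $\gamma_{k+1}(\pi)=[\pi,\gamma_k(\pi)]$, and let $$\mathcal I_g^1[d]=\ker\bigl(\mathrm{Mod}_g^1\to\mathrm{Aut}(\pi/\gamma_{d+1}(\pi))\bigr)$$ be the $d$-th term of the Johnson filtration. Let $\mathcal L(H)=\bigoplus_{k\ge1}\mathcal L_k(H)$ be the free Lie algebra on $H$, realized as the Lie subalgebra generated by $H$ in the tensor algebra of $H$ and graded by tensor degree. For $w\in\gamma_k(\pi)$ let $[\![w]\!]_k\in\mathcal L_k(H)$ be its image under the identification $\gamma_k(\pi)/\gamma_{k+1}(\pi)\otimes\mathbb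 Q\cong\mathcal L_k(H)$, that is, under the unique family of homomorphisms $[\![\cdot]\!]_k:\gamma_k(\pi)\to\mathcal L_k(H)$, $k\ge 1$, such that $[\![x]\!]_1$ is the homology class of $x\in\pi$ and $[\![\,xwx^{-1}w^{-1}]\!]_{k+1}=[\,[\![x]\!]_1,[\![w]\!]_k]$ for $x\in\pi$, $w\in\gamma_k(\pi)$. The $d$-th Johnson homomorphism is the unique homomorphism $$\tau_d:\mathcal I_g^1[d]\to H\otimes\mathcal L_{d+1}(H)$$ such that, for every $f\in\mathcal I_g^1[d]$, the map $H\to\mathcal L_{d+1}(H)$ corresponding to $\tau_d(f)$ under the identification $y\otimes\kappa\mapsto(h\mapsto\omega(y,h)\,\kappa)$ sends the homology class of each $x\in\pi$ to $[\![f(x)x^{-1}]\!]_{d+1}$. Then $\omega$, the maps $[\![\cdot]\!]_k$ and $\tau_d$ are well defined (they exist and are unique), and the image of $\tau_d$ is contained in the kernel of the Lie bracket map $$H\otimes\mathcal L_{d+1}(H)\to\mathcal L_{d+2}(H),\qquad h\otimes\kappa\mapsto[h,\kappa].$$ -/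

import Mathlib

open scoped TensorProduct

namespace Johnson

noncomputable section

open scoped commutatorElement

/-! ### The surface of genus `g` with one boundary component

The closed unit disc is regarded as a polygon with `4 g + 1` sides, numbered counterclockwise
from the point `1`; the sides are glued according to the word
`α₀ β₀ α₀⁻¹ β₀⁻¹ ⋯ α_{g-1} β_{g-1} α_{g-1}⁻¹ β_{g-1}⁻¹ δ`, in which the last side `δ` is left free. -/

/-- The closed unit disc. -/
abbrev Disc : Type := Metric.closedBall (0 : ℂ) 1

/-- The point at time `t` on side number `k` of the `(4 g + 1)`-gon. -/
def sidePoint (g k : ℕ) (t : unitInterval) : Disc :=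
  ⟨(Circle.exp (2 * Real.pi * ((k + (t : ℝ)) / (4 * g + 1))) : ℂ), by
    rw [mem_closedBall_zero_iff, Circle.norm_coe]⟩

/-- The side pairing: sides `4 i` and `4 i + 2`, and sides `4 i + 1` and `4 i + 3`, are
identified with reversed directions, for `i < g`. -/
inductive SideRel (g : ℕ) : Disc → Disc → Prop
  | alpha (i : Fin g) (t : unitInterval) :
      SideRel g (sidePoint g (4 * i) t) (sidePoint g (4 * i + 2) (unitInterval.symm t))
  | beta (i : Fin g) (t : unitInterval) :
      SideRel g (sidePoint g (4 * i + 1) t) (sidePoint g (4 * i + 3) (unitInterval.symm t))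

/-- The compact orientable surface `Σ_g^1` of genus `g` with one boundary component. -/
def Surface (g : ℕ) : Type := Quot (SideRel g)

instance (g : ℕ) : TopologicalSpace (Surface g) :=
  inferInstanceAs (TopologicalSpace (Quot (SideRel g)))

/-- The quotient map from the polygon to the surface. -/
def toSurface (g : ℕ) (z : Disc) : Surface g := Quot.mk _ z

/-- The boundary circle `∂Σ_g^1`: the image of the free side. -/
def boundary (g : ℕ) : Set (Surface g) :=
  Set.range fun t : unitInterval => toSurface g (sidePoint g (4 * g) t)

/-- The basepoint: the common image of all the vertices of the polygon. -/
def basept (g : ℕ) : Surface g := toSurface g (sidePoint g 0 0)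

theorem continuous_sidePoint (g k : ℕ) : Continuous (sidePoint g k) := by
  unfold sidePoint
  fun_prop

theorem continuous_toSurface (g : ℕ) : Continuous (toSurface g) := continuous_quot_mk

theorem sidePoint_one (g k : ℕ) : sidePoint g k 1 = sidePoint g (k + 1) 0 := by
  simp [sidePoint]

theorem sidePoint_last (g : ℕ) : sidePoint g (4 * g) 1 = sidePoint g 0 0 := by
  have h : (4 * (g : ℝ) + 1) ≠ 0 := by positivity
  simp [sidePoint, div_self h]

theorem basept_mem_boundary (g : ℕ) : basept g ∈ boundary g :=
  ⟨1, by simp only [basept, sidePoint_last]⟩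

theorem vertex_step (g : ℕ) (i : Fin g) :
    toSurface g (sidePoint g (4 * i) 0) = toSurface g (sidePoint g (4 * i + 3) 0) ∧
    toSurface g (sidePoint g (4 * i + 1) 0) = toSurface g (sidePoint g (4 * i + 2) 0) ∧
    toSurface g (sidePoint g (4 * i + 1) 0) = toSurface g (sidePoint g (4 * i + 4) 0) ∧
    toSurface g (sidePoint g (4 * i + 2) 0) = toSurface g (sidePoint g (4 * i + 3) 0) := by
  have a0 : toSurface g _ = toSurface g _ := Quot.sound (SideRel.alpha i 0)
  have a1 : toSurface g _ = toSurface g _ := Quot.sound (SideRel.alpha i 1)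
  have b0 : toSurface g _ = toSurface g _ := Quot.sound (SideRel.beta i 0)
  have b1 : toSurface g _ = toSurface g _ := Quot.sound (SideRel.beta i 1)
  simp only [unitInterval.symm_zero, unitInterval.symm_one, sidePoint_one] at a0 a1 b0 b1
  exact ⟨a0, a1, b0, b1⟩

theorem vertex_four_mul (g : ℕ) (k : ℕ) (hk : k ≤ g) :
    toSurface g (sidePoint g (4 * k) 0) = basept g := by
  induction k with
  | zero => rfl
  | succ k ih =>
    obtain ⟨h1, h2, h3, h4⟩ := vertex_step g ⟨k, hk⟩
    rw [show 4 * (k + 1) = 4 * k + 4 by ring, ← ih (Nat.le_of_succ_le hk)]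
    exact (h3.symm.trans h2).trans (h4.trans h1.symm)

theorem vertex_alpha_zero (g : ℕ) (i : Fin g) :
    toSurface g (sidePoint g (4 * i) 0) = basept g :=
  vertex_four_mul g i i.2.le

theorem vertex_beta_one (g : ℕ) (i : Fin g) :
    toSurface g (sidePoint g (4 * i + 1) 1) = basept g := by
  obtain ⟨h1, h2, h3, h4⟩ := vertex_step g i
  rw [sidePoint_one, ← vertex_alpha_zero g i]
  exact h4.trans h1.symm

theorem vertex_beta_zero (g : ℕ) (i : Fin g) :
    toSurface g (sidePoint g (4 * i + 1) 0) = basept g := by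
  obtain ⟨h1, h2, h3, h4⟩ := vertex_step g i
  rw [← vertex_alpha_zero g i]
  exact h2.trans (h4.trans h1.symm)

theorem vertex_alpha_one (g : ℕ) (i : Fin g) :
    toSurface g (sidePoint g (4 * i) 1) = basept g := by
  rw [sidePoint_one, vertex_beta_zero]

/-- The loop `α_i`: side `4 i` of the polygon. -/
def alphaLoop (g : ℕ) (i : Fin g) : Path (basept g) (basept g) where
  toFun t := toSurface g (sidePoint g (4 * i) t)
  continuous_toFun := (continuous_toSurface g).comp (continuous_sidePoint g _)
  source' := vertex_alpha_zero g i
  target' := vertex_alpha_one g i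

/-- The loop `β_i`: side `4 i + 1` of the polygon. -/
def betaLoop (g : ℕ) (i : Fin g) : Path (basept g) (basept g) where
  toFun t := toSurface g (sidePoint g (4 * i + 1) t)
  continuous_toFun := (continuous_toSurface g).comp (continuous_sidePoint g _)
  source' := vertex_beta_zero g i
  target' := vertex_beta_one g i

/-! ### Fundamental group and first homology -/

/-- `π = π₁(Σ_g^1, *)`. -/
abbrev Pi1 (g : ℕ) : Type := FundamentalGroup (Surface g) (basept g)

/-- The class of a loop in `π`. -/
def loopClass {g : ℕ} (p : Path (basept g) (basept g)) : Pi1 g :=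
  FundamentalGroup.fromPath (Path.Homotopic.Quotient.mk p)

/-- `H = H₁(Σ_g^1; ℚ) = π^ab ⊗ ℚ`. -/
abbrev H1 (g : ℕ) : Type := ℚ ⊗[ℤ] Additive (Abelianization (Pi1 g))

/-- The homology class of an element of `π`. -/
def hclass {g : ℕ} (x : Pi1 g) : H1 g := 1 ⊗ₜ[ℤ] Additive.ofMul (Abelianization.of x)

/-- `ω` is the algebraic intersection form on `H`: the alternating bilinear form with
`a_i · b_j = δ_{ij}` and `a_i · a_j = b_i · b_j = 0`, where `a_i`, `b_i` are the homology classes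
of the side loops `α_i`, `β_i`. (These classes form a basis of `H`, so this determines `ω`.) -/
structure IsIntersectionForm (g : ℕ) (ω : LinearMap.BilinForm ℚ (H1 g)) : Prop where
  alt : ω.IsAlt
  alpha_alpha : ∀ i j : Fin g,
    ω (hclass (loopClass (alphaLoop g i))) (hclass (loopClass (alphaLoop g j))) = 0
  beta_beta : ∀ i j : Fin g,
    ω (hclass (loopClass (betaLoop g i))) (hclass (loopClass (betaLoop g j))) = 0
  alpha_beta : ∀ i j : Fin g,
    ω (hclass (loopClass (alphaLoop g i))) (hclass (loopClass (betaLoop g j))) =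
      if i = j then 1 else 0

/-! ### The mapping class group and its action on `π` -/

/-- The group of homeomorphisms of `Σ_g^1` that fix the boundary pointwise. (Since the boundary is
nonempty, such homeomorphisms preserve the orientation.) -/
def homeoRelBoundary (g : ℕ) : Subgroup (Surface g ≃ₜ Surface g) where
  carrier := {f | ∀ x ∈ boundary g, f x = x}
  one_mem' := fun _ _ => rfl
  mul_mem' := by
    intro f h hf hh x hx
    rw [Homeomorph.mul_apply, hh x hx, hf x hx]
  inv_mem' := by
    intro f hf x hx
    have := hf x hx
    calc f⁻¹ x = f⁻¹ (f x) := by rw [this]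
      _ = x := f.symm_apply_apply x

/-- The normal subgroup of the homeomorphisms isotopic to the identity, by an isotopy through
homeomorphisms that fix the boundary pointwise. -/
def isotopicToId (g : ℕ) : Subgroup (homeoRelBoundary g) where
  carrier := {f | ∃ F : unitInterval → homeoRelBoundary g,
    Continuous (fun p : unitInterval × Surface g => (F p.1).1 p.2) ∧ F 0 = 1 ∧ F 1 = f}
  one_mem' := ⟨fun _ => 1, continuous_snd, rfl, rfl⟩
  mul_mem' := by
    rintro f h ⟨F, hF, F0, F1⟩ ⟨K, hK, K0, K1⟩
    exact ⟨fun t => F t * K t, hF.comp (continuous_fst.prodMk hK), by simp [F0, K0],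
      by simp [F1, K1]⟩
  inv_mem' := by
    rintro f ⟨F, hF, F0, F1⟩
    refine ⟨fun t => f⁻¹ * F (unitInterval.symm t), ?_, by simp [F1], by simp [F0]⟩
    exact (f⁻¹).1.continuous.comp
      (hF.comp ((unitInterval.continuous_symm.comp continuous_fst).prodMk continuous_snd))

instance isotopicToId_normal (g : ℕ) : (isotopicToId g).Normal where
  conj_mem := by
    rintro f ⟨F, hF, F0, F1⟩ h
    refine ⟨fun t => h * F t * h⁻¹, ?_, by simp [F0], by simp [F1]⟩
    exact h.1.continuous.comp
      (hF.comp (continuous_fst.prodMk ((h⁻¹).1.continuous.comp continuous_snd)))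

/-- The mapping class group `Mod_g^1`. -/
abbrev MCG (g : ℕ) : Type := homeoRelBoundary g ⧸ isotopicToId g

theorem homeo_basept {g : ℕ} (f : homeoRelBoundary g) : f.1 (basept g) = basept g :=
  f.2 _ (basept_mem_boundary g)

/-- The endomorphism of `π` induced by a homeomorphism that fixes the boundary. -/
def inducedHom {g : ℕ} (f : homeoRelBoundary g) : Pi1 g →* Pi1 g :=
  FundamentalGroup.mapOfEq (f.1 : C(Surface g, Surface g)) (homeo_basept f)

theorem inducedHom_loopClass {g : ℕ} (f : homeoRelBoundary g) (p : Path (basept g) (basept g)) :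
    inducedHom f (loopClass p) =
      loopClass ((p.map f.1.continuous).cast (homeo_basept f).symm (homeo_basept f).symm) := by
  exact FundamentalGroup.mapOfEq_apply _ _ _

theorem loopClass_surjective {g : ℕ} (x : Pi1 g) : ∃ p, loopClass p = x := by
  induction x using Quotient.inductionOn with
  | h p => exact ⟨p, rfl⟩

theorem inducedHom_one (g : ℕ) : inducedHom (1 : homeoRelBoundary g) = MonoidHom.id _ := by
  ext x
  obtain ⟨p, rfl⟩ := loopClass_surjective x
  rw [inducedHom_loopClass]
  rfl

theorem inducedHom_mul {g : ℕ} (f h : homeoRelBoundary g) :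
    inducedHom (f * h) = (inducedHom f).comp (inducedHom h) := by
  ext x
  obtain ⟨p, rfl⟩ := loopClass_surjective x
  rw [MonoidHom.comp_apply, inducedHom_loopClass, inducedHom_loopClass, inducedHom_loopClass]
  rfl

theorem inducedHom_of_isotopic {g : ℕ} (f : homeoRelBoundary g) (hf : f ∈ isotopicToId g) :
    inducedHom f = MonoidHom.id _ := by
  obtain ⟨F, hF, F0, F1⟩ := hf
  ext x
  obtain ⟨p, rfl⟩ := loopClass_surjective x
  rw [inducedHom_loopClass, MonoidHom.id_apply]
  refine Quotient.sound (Path.Homotopic.symm ⟨?_⟩)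
  exact
    { toFun := fun q => (F q.1).1 (p q.2)
      continuous_toFun := hF.comp (continuous_fst.prodMk (p.continuous.comp continuous_snd))
      map_zero_left := fun t => by simp [F0]
      map_one_left := fun t => by simp [F1]
      prop' := by
        rintro t s (rfl | rfl)
        · simpa using homeo_basept (F t)
        · simpa using homeo_basept (F t) }

/-- The action of homeomorphisms on `π` by automorphisms. -/
def homeoAction (g : ℕ) : homeoRelBoundary g →* MulAut (Pi1 g) where
  toFun f := MonoidHom.toMulEquiv (inducedHom f) (inducedHom f⁻¹)
    (by rw [← inducedHom_mul, inv_mul_cancel, inducedHom_one])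
    (by rw [← inducedHom_mul, mul_inv_cancel, inducedHom_one])
  map_one' := by
    ext x
    exact DFunLike.congr_fun (inducedHom_one g) x
  map_mul' f h := by
    ext x
    exact DFunLike.congr_fun (inducedHom_mul f h) x

/-- The action of the mapping class group on `π`. -/
def mcgAction (g : ℕ) : MCG g →* MulAut (Pi1 g) :=
  QuotientGroup.lift (isotopicToId g) (homeoAction g) (by
    intro f hf
    ext x
    exact DFunLike.congr_fun (inducedHom_of_isotopic f hf) x)

/-! ### The Johnson filtration -/

/-- The lower central series of `π`, with `γ_1(π) = π`. (The value at `0` is `π`.) -/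
abbrev gam (g d : ℕ) : Subgroup (Pi1 g) := (⊤ : Subgroup (Pi1 g)).lowerCentralSeries (d - 1)

/-- The term `I_g^1[d]` of the Johnson filtration: the kernel of the action of `Mod_g^1` on
`π / γ_{d+1}(π)`. -/
def johnsonFiltration (g d : ℕ) : Subgroup (MCG g) where
  carrier := {f | ∀ x : Pi1 g,
    (QuotientGroup.mk (mcgAction g f x) : Pi1 g ⧸ gam g (d + 1)) = QuotientGroup.mk x}
  one_mem' := fun x => by simp
  mul_mem' := by
    intro f h hf hh x
    rw [map_mul, MulAut.mul_apply, hf, hh]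
  inv_mem' := by
    intro f hf x
    have h := hf (mcgAction g f⁻¹ x)
    rw [← MulAut.mul_apply, ← map_mul, mul_inv_cancel, map_one, MulAut.one_apply] at h
    exact h.symm

/-- For `f ∈ I_g^1[d]` and `x ∈ π`, the element `f(x) x⁻¹` of `γ_{d+1}(π)`. -/
def leftDiff {g d : ℕ} (f : johnsonFiltration g d) (x : Pi1 g) : gam g (d + 1) :=
  ⟨mcgAction g f.1 x * x⁻¹, by
    have h := (QuotientGroup.eq.mp (f.2 x).symm)
    have hn : (gam g (d + 1)).Normal := inferInstance
    exact hn.mem_comm h⟩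

/-! ### The free Lie algebra -/

section FreeLie

attribute [local instance] LieRing.ofAssociativeRing

variable (V : Type) [AddCommGroup V] [Module ℚ V]

/-- The free Lie algebra on the vector space `V`: the Lie subalgebra generated by `V` in the
tensor algebra of `V`, with bracket `[s, t] = s t - t s`. -/
def freeLie : LieSubalgebra ℚ (TensorAlgebra ℚ V) :=
  LieSubalgebra.lieSpan ℚ (TensorAlgebra ℚ V) (Set.range (TensorAlgebra.ι ℚ))

/-- The graded piece of degree `d` of the free Lie algebra: its elements that are homogeneous of
degree `d` in the tensor algebra. -/
def freeLieDeg (d : ℕ) : Submodule ℚ (TensorAlgebra ℚ V) :=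
  (freeLie V).toSubmodule ⊓ LinearMap.range (TensorAlgebra.ι ℚ : V →ₗ[ℚ] TensorAlgebra ℚ V) ^ d

variable {V}

theorem ι_mem_freeLieDeg (v : V) : TensorAlgebra.ι ℚ v ∈ freeLieDeg V 1 :=
  ⟨LieSubalgebra.subset_lieSpan ⟨v, rfl⟩, by rw [pow_one]; exact ⟨v, rfl⟩⟩

theorem lie_ι_mem_freeLieDeg (v : V) {d : ℕ} {u : TensorAlgebra ℚ V} (hu : u ∈ freeLieDeg V d) :
    ⁅TensorAlgebra.ι ℚ v, u⁆ ∈ freeLieDeg V (d + 1) := by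
  refine ⟨(freeLie V).lie_mem (LieSubalgebra.subset_lieSpan ⟨v, rfl⟩) hu.1, ?_⟩
  rw [Ring.lie_def]
  refine Submodule.sub_mem _ ?_ ?_
  · rw [pow_succ']
    exact Submodule.mul_mem_mul ⟨v, rfl⟩ hu.2
  · rw [pow_succ]
    exact Submodule.mul_mem_mul hu.2 ⟨v, rfl⟩

variable (V)

/-- The inclusion of `V` as the degree `1` part of the free Lie algebra. -/
def freeLieGen : V →ₗ[ℚ] freeLieDeg V 1 :=
  (TensorAlgebra.ι ℚ).codRestrict _ ι_mem_freeLieDeg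

/-- The bracket `(v, u) ↦ [v, u]` with elements of degree `1`. -/
def lieGen (d : ℕ) : V →ₗ[ℚ] freeLieDeg V d →ₗ[ℚ] freeLieDeg V (d + 1) :=
  LinearMap.mk₂ ℚ (fun v u => ⟨⁅TensorAlgebra.ι ℚ v, u.1⁆, lie_ι_mem_freeLieDeg v u.2⟩)
    (fun v w u => Subtype.ext (by simp))
    (fun c v u => Subtype.ext (by simp))
    (fun v u w => Subtype.ext (by simp))
    (fun c v u => Subtype.ext (by simp))

/-- The Lie bracket map `V ⊗ L_d(V) → L_{d+1}(V)`, `v ⊗ u ↦ [v, u]`. -/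
def lieBracketMap (d : ℕ) : V ⊗[ℚ] freeLieDeg V d →ₗ[ℚ] freeLieDeg V (d + 1) :=
  TensorProduct.lift (lieGen V d)

end FreeLie

/-! ### The symbol maps and the Johnson homomorphism -/

/-- The commutator `[x, w]` of `x ∈ π` and `w ∈ γ_{n+1}(π)`, as an element of `γ_{n+2}(π)`. -/
def commElt {g n : ℕ} (x : Pi1 g) (w : gam g (n + 1)) : gam g (n + 2) :=
  ⟨⁅x, w.1⁆, by
    have h : ⁅w.1, x⁆ ∈ gam g (n + 2) :=
      Subgroup.commutator_mem_commutator w.2 (Subgroup.mem_top x)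
    rw [← commutatorElement_inv]
    exact inv_mem h⟩

/-- The family `σ_n : γ_{n+1}(π) → L_{n+1}(H)`, `w ↦ ⟦w⟧_{n+1}`, of homomorphisms expresses the
identification of the Lie algebra `⨁ γ_k(π)/γ_{k+1}(π) ⊗ ℚ` with the free Lie algebra on
`H = γ_1(π)/γ_2(π) ⊗ ℚ`: it is the identity in degree `1` and takes commutators to brackets.
As `γ_{n+2}(π)` is generated by the commutators `[x, w]` with `x ∈ π` and `w ∈ γ_{n+1}(π)`, these
conditions determine it, and they imply that `σ_n` vanishes on `γ_{n+2}(π)`. -/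
structure IsSymbol (g : ℕ)
    (σ : ∀ n : ℕ, Additive (gam g (n + 1)) →+ freeLieDeg (H1 g) (n + 1)) : Prop where
  degree_one : ∀ x : gam g 1, σ 0 (Additive.ofMul x) = freeLieGen (H1 g) (hclass x.1)
  commutator : ∀ (n : ℕ) (x : Pi1 g) (w : gam g (n + 1)),
    σ (n + 1) (Additive.ofMul (commElt x w)) =
      lieGen (H1 g) (n + 1) (hclass x) (σ n (Additive.ofMul w))

/-- The linear map `H ⊗ L → L`, `y ⊗ κ ↦ ω(y, h) κ`. As `h` varies, this is the identification of
`H ⊗ L` with `Hom(H, L)` given by `ω`. -/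
def contract {V L : Type} [AddCommGroup V] [Module ℚ V] [AddCommGroup L] [Module ℚ L]
    (ω : LinearMap.BilinForm ℚ V) (h : V) : V ⊗[ℚ] L →ₗ[ℚ] L :=
  (TensorProduct.lid ℚ L).toLinearMap ∘ₗ LinearMap.rTensor L (ω.flip h)

/-- `τ` is the `d`-th Johnson homomorphism `I_g^1[d] → H ⊗ L_{d+1}(H)`: under the identification
of `H ⊗ L_{d+1}(H)` with `Hom(H, L_{d+1}(H)) = Hom(π, L_{d+1}(H))` given by `ω`, the element
`τ(f)` is the map `x ↦ ⟦f(x) x⁻¹⟧_{d+1}`. -/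
def IsJohnsonHom (g d : ℕ) (ω : LinearMap.BilinForm ℚ (H1 g))
    (σ : ∀ n : ℕ, Additive (gam g (n + 1)) →+ freeLieDeg (H1 g) (n + 1))
    (τ : Additive (johnsonFiltration g d) →+ H1 g ⊗[ℚ] freeLieDeg (H1 g) (d + 1)) : Prop :=
  ∀ (f : johnsonFiltration g d) (x : Pi1 g),
    contract ω (hclass x) (τ (Additive.ofMul f)) = σ d (Additive.ofMul (leftDiff f x))

end

end Johnson

/-!
Straight segments in the polygon deform `Σ` to the one-point union of the side loops `α_i`, `β_i`,
so that `π` is free on them, and the leading terms of the Magnus expansion give the maps `⟦·⟧_k`.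

A mapping class `f` fixes the boundary loop, hence also its inverse, which is the image in `π` of
the part of the boundary of the polygon that is glued: a product of commutators in the side loops.
If `f` lies in the `d`-th term of the Johnson filtration, then `⟦f(w) w⁻¹⟧` is obtained from
`w ↦ ⟦f(w) w⁻¹⟧_{d+1}` on generators by the Leibniz rule, so that applying it to the boundary word
gives `∑ i, ([a_i, D b_i] - [b_i, D a_i]) = 0` for the map `D : H → 𝓛_{d+1}(H)` that corresponds to
`τ_d(f)`. As `a_i`, `b_i` is a symplectic basis of `H`, the left-hand side is, up to sign, the
bracket of `τ_d(f)`.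
-/

namespace Johnson

noncomputable section

open scoped Matrix commutatorElement

section PrincipalUnits

open PowerSeries

attribute [local instance] LieRing.ofAssociativeRing

variable (R : Type*) [Ring R]

/-- The group of the invertible power series that are congruent to `1` modulo `X ^ k`. -/
def principalUnits (k : ℕ) : Subgroup R⟦X⟧ˣ where
  carrier := {u | X ^ k ∣ (u - 1 : R⟦X⟧)}
  one_mem' := by simp
  mul_mem' {u v} hu hv := by
    have h : (↑(u * v) - 1 : R⟦X⟧) = (u - 1) * v + (v - 1) := by push_cast; noncomm_ring
    rw [Set.mem_ofPred, h]
    exact dvd_add (hu.mul_right _) hv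
  inv_mem' {u} hu := by
    have h : (↑u⁻¹ - 1 : R⟦X⟧) = -((u - 1) * (↑u⁻¹ : R⟦X⟧)) := by simp [sub_mul]
    rw [Set.mem_ofPred, h, dvd_neg]
    exact hu.mul_right _

variable {R}

theorem principalUnits_antitone : Antitone (principalUnits R) :=
  fun _ _ h _ hu => (pow_dvd_pow X h).trans hu

theorem constantCoeff_of_mem_principalUnits {k : ℕ} {u : R⟦X⟧ˣ}
    (hu : u ∈ principalUnits R (k + 1)) : constantCoeff (u : R⟦X⟧) = 1 := by
  obtain ⟨p, hp⟩ := hu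
  simp [sub_eq_iff_eq_add.mp hp]

theorem coeff_X_pow_mul_self (k : ℕ) (p : R⟦X⟧) : coeff k (X ^ k * p) = constantCoeff p := by
  simpa using coeff_X_pow_mul p k 0

theorem coeff_mul_sub_one {k : ℕ} {u v : R⟦X⟧ˣ} (hu : u ∈ principalUnits R k)
    (hv : v ∈ principalUnits R 1) :
    coeff k (↑(u * v) - 1 : R⟦X⟧) = coeff k (u - 1 : R⟦X⟧) + coeff k (v - 1 : R⟦X⟧) := by
  obtain ⟨p, hp⟩ := hu
  have h : (↑(u * v) - 1 : R⟦X⟧) = (u - 1) * v + (v - 1) := by push_cast; noncomm_ring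
  rw [h, map_add, hp, mul_assoc, coeff_X_pow_mul_self, coeff_X_pow_mul_self, map_mul,
    constantCoeff_of_mem_principalUnits hv, mul_one]

/-- The homomorphism that takes `1 + a X ^ (k + 1) + ⋯` to `a`. -/
def leadingCoeff (k : ℕ) : Additive (principalUnits R (k + 1)) →+ R :=
  AddMonoidHom.mk' (fun u => coeff (k + 1) (u.toMul.1 - 1 : R⟦X⟧)) fun u v =>
    coeff_mul_sub_one u.toMul.2 (principalUnits_antitone (Nat.le_add_left 1 k) v.toMul.2)

theorem commutator_sub_one_of_eq_X_pow_mul {k l : ℕ} {u v : R⟦X⟧ˣ} {p q : R⟦X⟧}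
    (hu : (u - 1 : R⟦X⟧) = X ^ k * p) (hv : (v - 1 : R⟦X⟧) = X ^ l * q) :
    (↑⁅u, v⁆ - 1 : R⟦X⟧) = X ^ (k + l) * ((p * q - q * p) * (↑(u⁻¹ * v⁻¹) : R⟦X⟧)) := by
  have comm_sub : (u * v - v * u : R⟦X⟧) = X ^ (k + l) * (p * q - q * p) :=
    calc (u * v - v * u : R⟦X⟧) = (u - 1) * (v - 1) - (v - 1) * (u - 1) := by noncomm_ring
      _ = X ^ k * (p * X ^ l) * q - X ^ l * (q * X ^ k) * p := by
        simp only [hu, hv, mul_assoc]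
      _ = X ^ (k + l) * (p * q - q * p) := by
        rw [← X_pow_mul, ← X_pow_mul, mul_sub, pow_add]
        simp only [← mul_assoc, ← pow_add, add_comm]
  calc (↑⁅u, v⁆ - 1 : R⟦X⟧) = (u * v - v * u) * (↑(u⁻¹ * v⁻¹) : R⟦X⟧) := by
        simp [commutatorElement_def, sub_mul, mul_assoc]
    _ = X ^ (k + l) * ((p * q - q * p) * (↑(u⁻¹ * v⁻¹) : R⟦X⟧)) := by rw [comm_sub, mul_assoc]

theorem commutator_mem_principalUnits {k l : ℕ} {u v : R⟦X⟧ˣ} (hu : u ∈ principalUnits R k)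
    (hv : v ∈ principalUnits R l) : ⁅u, v⁆ ∈ principalUnits R (k + l) := by
  obtain ⟨p, hp⟩ := hu
  obtain ⟨q, hq⟩ := hv
  exact ⟨_, commutator_sub_one_of_eq_X_pow_mul hp hq⟩

theorem coeff_commutator_sub_one {k l : ℕ} {u v : R⟦X⟧ˣ} (hu : u ∈ principalUnits R (k + 1))
    (hv : v ∈ principalUnits R (l + 1)) :
    coeff (k + 1 + (l + 1)) (↑⁅u, v⁆ - 1 : R⟦X⟧) =
      ⁅coeff (k + 1) (u - 1 : R⟦X⟧), coeff (l + 1) (v - 1 : R⟦X⟧)⁆ := by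
  obtain ⟨p, hp⟩ := id hu
  obtain ⟨q, hq⟩ := id hv
  have hinv := constantCoeff_of_mem_principalUnits (k := 0) (mul_mem
    (principalUnits_antitone (Nat.le_add_left 1 k) (inv_mem hu))
    (principalUnits_antitone (Nat.le_add_left 1 l) (inv_mem hv)))
  rw [commutator_sub_one_of_eq_X_pow_mul hp hq, hp, hq]
  simp only [coeff_X_pow_mul_self, map_mul constantCoeff, hinv, map_sub, mul_one, Ring.lie_def]

/-- The invertible power series `1 + a X`. -/
def oneAddMulX (a : R) : principalUnits R 1 :=
  have h : constantCoeff (1 + C a * X : R⟦X⟧) = ((1 : Rˣ) : R) := by simp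
  ⟨⟨1 + C a * X, invOfUnit _ 1, mul_invOfUnit _ _ h, invOfUnit_mul _ _ h⟩,
    C a, by simp [X_mul]⟩

theorem leadingCoeff_oneAddMulX (a : R) : leadingCoeff 0 (.ofMul (oneAddMulX a)) = a := by
  simp [leadingCoeff, oneAddMulX]

end PrincipalUnits

section LocalGeneration

open scoped unitInterval Topology

variable {X : Type*} [TopologicalSpace X] {x₀ x y z : X}

/-- The class of the loop `ρ x · p · (ρ y)⁻¹`, where `ρ` is a choice of paths from the basepoint.
This extends loop classes to a groupoid homomorphism on the homotopy classes of all paths. -/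
def conjLoop (ρ : ∀ x, Path x₀ x) (p : Path x y) : FundamentalGroup X x₀ :=
  FundamentalGroup.fromPath (.mk ((ρ x).trans (p.trans (ρ y).symm)))

variable (ρ : ∀ x, Path x₀ x)

theorem conjLoop_congr {p q : Path x y} (h : p.Homotopic q) : conjLoop ρ p = conjLoop ρ q :=
  Path.Homotopic.Quotient.eq.mpr (.hcomp (.refl _) (.hcomp h (.refl _)))

theorem conjLoop_eq_of_forall {x' y' : X} {p : Path x y} {q : Path x' y'} (h : ∀ t, p t = q t) :
    conjLoop ρ p = conjLoop ρ q := by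
  obtain rfl : x = x' := by simpa using h 0
  obtain rfl : y = y' := by simpa using h 1
  obtain rfl : p = q := Path.ext (funext h)
  rfl

theorem conjLoop_trans (p : Path x y) (q : Path y z) :
    conjLoop ρ (p.trans q) = conjLoop ρ q * conjLoop ρ p := by
  rw [FundamentalGroup.mul_def]
  simp only [conjLoop, FundamentalGroup.fromPath, FundamentalGroup.fromArrow,
    Path.Homotopic.Quotient.mk_trans, Path.Homotopic.Quotient.mk_symm]
  grind

theorem conjLoop_refl (x : X) : conjLoop ρ (.refl x) = 1 := by
  have h := conjLoop_trans ρ (.refl x) (.refl x)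
  rw [Path.refl_trans_refl] at h
  exact left_eq_mul.mp h

theorem conjLoop_eq_one_of_continuous (p : Path x y)
    (h : Continuous fun q : I × I => ρ (p q.1) q.2) : conjLoop ρ p = 1 := by
  let loop (t : I) : Path x₀ x₀ := (ρ (p 0)).trans ((p.subpath 0 t).trans (ρ (p t)).symm)
  have hsubpath : Continuous ↿fun t => p.subpath 0 t :=
    p.subpath_continuous_family.comp (continuous_const.prodMk continuous_id)
  have hloop : Continuous ↿loop :=
    Path.trans_continuous_family (fun _ => ρ (p 0)) ((ρ (p 0)).continuous.comp continuous_snd) _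
      (Path.trans_continuous_family _ hsubpath _
        (Path.symm_continuous_family (fun t => ρ (p t)) h))
  have homotopic : (loop 0).Homotopic (loop 1) := ⟨
    { toFun := fun q => loop q.1 q.2
      continuous_toFun := hloop
      map_zero_left := fun _ => rfl
      map_one_left := fun _ => rfl
      prop' := by rintro t s (rfl | rfl) <;> simp }⟩
  calc conjLoop ρ p = conjLoop ρ (p.subpath 0 1) := conjLoop_eq_of_forall ρ (by simp)
    _ = conjLoop ρ (p.subpath 0 0) := (Path.Homotopic.Quotient.eq.mpr homotopic).symm
    _ = 1 := by rw [Path.subpath_self, conjLoop_refl]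

variable {ρ}

theorem conjLoop_loop (hρ : ρ x₀ = .refl x₀) (p : Path x₀ x₀) :
    conjLoop ρ p = FundamentalGroup.fromPath (.mk p) := by
  simp only [conjLoop, Path.Homotopic.Quotient.mk_trans, Path.refl_symm, hρ,
    Path.Homotopic.Quotient.mk_refl, Path.Homotopic.Quotient.refl_trans,
    Path.Homotopic.Quotient.trans_refl]

theorem conjLoop_tree (hρ : ρ x₀ = .refl x₀) (x : X) : conjLoop ρ (ρ x) = 1 := by
  rw [FundamentalGroup.one_def]
  simp only [conjLoop, FundamentalGroup.fromPath, FundamentalGroup.fromArrow,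
    Path.Homotopic.Quotient.mk_trans, Path.Homotopic.Quotient.mk_symm, hρ,
    Path.Homotopic.Quotient.mk_refl, Path.Homotopic.Quotient.refl_trans,
    Path.Homotopic.Quotient.trans_symm]

theorem isLocallyConstant_conjLoop_subpath_mem {S : Subgroup (FundamentalGroup X x₀)}
    (h : ∀ x, ∃ U ∈ 𝓝 x, ∀ (y z : X) (p : Path y z), Set.range p ⊆ U → conjLoop ρ p ∈ S)
    (γ : Path x y) : IsLocallyConstant fun t : I => conjLoop ρ (γ.subpath 0 t) ∈ S := by
  rw [IsLocallyConstant.iff_eventually_eq]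
  intro t
  obtain ⟨U, hU, hUS⟩ := h (γ t)
  have hnear : ∀ᶠ s in 𝓝 t, Set.uIcc t s ⊆ γ ⁻¹' U :=
    (tendsto_const_nhds.uIcc Filter.tendsto_id).eventually
      (Filter.eventually_smallSets.mpr ⟨_, γ.continuous.continuousAt hU, fun _ => id⟩)
  filter_upwards [hnear] with s hs
  have hmem : conjLoop ρ (γ.subpath t s) ∈ S := by
    refine hUS _ _ _ ?_
    rw [Path.range_subpath]
    exact Set.image_subset_iff.mpr hs
  rw [← conjLoop_congr ρ ⟨Path.Homotopy.subpathTransSubpath γ 0 t s⟩, conjLoop_trans]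
  exact propext (S.mul_mem_cancel_left hmem)

theorem eq_top_of_locally_conjLoop_mem (hρ : ρ x₀ = .refl x₀)
    {S : Subgroup (FundamentalGroup X x₀)}
    (h : ∀ x, ∃ U ∈ 𝓝 x, ∀ (y z : X) (p : Path y z), Set.range p ⊆ U → conjLoop ρ p ∈ S) :
    S = ⊤ := by
  refine (Subgroup.eq_top_iff' S).mpr fun c => ?_
  obtain ⟨γ, rfl⟩ := Path.Homotopic.Quotient.mk_surjective c
  have hconst := (isLocallyConstant_conjLoop_subpath_mem h γ).apply_eq_of_preconnectedSpace 0 1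
  have hzero : conjLoop ρ (γ.subpath 0 0) ∈ S := by
    rw [Path.subpath_self, conjLoop_refl]
    exact S.one_mem
  have hone : conjLoop ρ (γ.subpath 0 1) = FundamentalGroup.fromPath (.mk γ) := by
    rw [← conjLoop_loop hρ, conjLoop_eq_of_forall ρ (q := γ) (by simp)]
  rw [hone] at hconst
  exact hconst.mp hzero

end LocalGeneration

section CirclePhase

/-- The representative in `[0, 1)` of a point of the circle. -/
def phase (w : UnitAddCircle) : ℝ := AddCircle.equivIco 1 0 w

/-- The representative in `(-1/2, 1/2]` of a point of the circle. -/
def signedPhase (w : UnitAddCircle) : ℝ := AddCircle.equivIoc 1 (-(1 / 2)) w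

@[simp]
theorem coe_phase (w : UnitAddCircle) : (phase w : UnitAddCircle) = w :=
  AddCircle.coe_equivIco

@[simp]
theorem coe_signedPhase (w : UnitAddCircle) : (signedPhase w : UnitAddCircle) = w :=
  AddCircle.coe_equivIoc

theorem phase_mem_Ico (w : UnitAddCircle) : phase w ∈ Set.Ico (0 : ℝ) 1 := by
  simpa only [zero_add] using! (AddCircle.equivIco 1 0 w).2

theorem phase_coe {a : ℝ} (ha : a ∈ Set.Ico (0 : ℝ) 1) : phase a = a :=
  AddCircle.equivIco_coe_of_mem (by simpa only [zero_add] using ha)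

theorem signedPhase_coe {a : ℝ} (ha : a ∈ Set.Ioc (-(1 / 2) : ℝ) (1 / 2)) : signedPhase a = a :=
  AddCircle.equivIoc_coe_of_mem (by norm_num at ha ⊢; exact ha)

@[simp]
theorem signedPhase_zero : signedPhase 0 = 0 :=
  signedPhase_coe (a := 0) (by norm_num)

theorem coe_half_ne_zero : ((1 / 2 : ℝ) : UnitAddCircle) ≠ 0 := fun h => by
  have hhalf := phase_coe (a := 1 / 2) (by norm_num)
  have hzero := phase_coe (a := 0) (by norm_num)
  rw [h] at hhalf
  exact absurd (hhalf.symm.trans hzero) (by norm_num)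

theorem coe_sub_one (a : ℝ) : ((a - 1 : ℝ) : UnitAddCircle) = a := by
  simp [AddCircle.coe_period]

theorem continuousAt_phase {w : UnitAddCircle} (hw : w ≠ 0) : ContinuousAt phase w :=
  continuous_subtype_val.continuousAt.comp (AddCircle.continuousAt_equivIco 1 0 (by simpa using hw))

theorem continuousAt_signedPhase {w : UnitAddCircle} (hw : w ≠ (1 / 2 : ℝ)) :
    ContinuousAt signedPhase w :=
  continuous_subtype_val.continuousAt.comp <| AddCircle.continuousAt_equivIoc 1 _ <| by
    rwa [← coe_sub_one, show (1 / 2 - 1 : ℝ) = -(1 / 2) by norm_num] at hw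

end CirclePhase

section Wedge

open scoped unitInterval Topology

/-- The one-point union of circles indexed by `ι`, as a subspace of the product of the circles:
at most one coordinate of a point differs from the common point `0` of the circles. -/
abbrev Wedge (ι : Type*) : Type _ := {z : ι → UnitAddCircle // ∀ i j, i ≠ j → z i = 0 ∨ z j = 0}

variable {ι : Type*}

/-- The common point of the circles. -/
def wedgeBase : Wedge ι := ⟨0, fun _ _ _ => .inl rfl⟩

theorem continuous_wedge_apply (i : ι) : Continuous fun z : Wedge ι => z.1 i :=
  (continuous_apply i).comp continuous_subtype_val

/-- The open cover of the one-point union by the complement of the midpoints of the circles and by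
the circles without the common point. -/
def wedgeChart : Option ι → Set (Wedge ι)
  | none => {z | ∀ i, z.1 i ≠ (1 / 2 : ℝ)}
  | some i => {z | z.1 i ≠ 0}

theorem isOpen_wedgeChart [Finite ι] (o : Option ι) : IsOpen (wedgeChart o) := by
  cases o with
  | none =>
    simp only [wedgeChart, Set.ofPred_forall]
    exact isOpen_iInter_of_finite fun i =>
      isOpen_ne_fun (continuous_wedge_apply i) continuous_const
  | some i => exact isOpen_ne_fun (continuous_wedge_apply i) continuous_const

theorem exists_mem_wedgeChart (z : Wedge ι) : ∃ o, z ∈ wedgeChart o := by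
  by_cases hz : ∃ i, z.1 i ≠ 0
  · obtain ⟨i, hi⟩ := hz
    exact ⟨some i, hi⟩
  · push Not at hz
    exact ⟨none, fun i h => coe_half_ne_zero (h.symm.trans (hz i))⟩

/-- The path from the common point which runs along the shorter arc of a circle. -/
def wedgeRadius (z : Wedge ι) : Path wedgeBase z where
  toFun t := ⟨fun i => ((t * signedPhase (z.1 i) : ℝ) : UnitAddCircle), fun i j h =>
    (z.2 i j h).imp (fun h0 => by simp [h0]) (fun h0 => by simp [h0])⟩
  continuous_toFun := by
    refine Continuous.subtype_mk (continuous_pi fun i => ?_) _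
    exact (AddCircle.continuous_mk' 1).comp (by fun_prop)
  source' := by simp [wedgeBase, Pi.zero_def]
  target' := by simp

theorem wedgeRadius_base : wedgeRadius (wedgeBase : Wedge ι) = .refl wedgeBase :=
  Path.ext <| funext fun t => Subtype.ext <| funext fun i => by
    change (((t : ℝ) * signedPhase 0 : ℝ) : UnitAddCircle) = 0
    rw [signedPhase_zero, mul_zero, AddCircle.coe_zero]

theorem conjLoop_wedgeRadius_of_ne_half {y z : Wedge ι} (p : Path y z)
    (hp : ∀ t i, (p t).1 i ≠ (1 / 2 : ℝ)) : conjLoop wedgeRadius p = 1 := by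
  refine conjLoop_eq_one_of_continuous _ _ (Continuous.subtype_mk (continuous_pi fun i => ?_) _)
  have hphase : Continuous fun t : I => signedPhase ((p t).1 i) :=
    continuous_iff_continuousAt.mpr fun t =>
      (continuousAt_signedPhase (hp t i)).comp (f := fun t => (p t).1 i)
        ((continuous_wedge_apply i).comp p.continuous).continuousAt
  exact (AddCircle.continuous_mk' 1).comp
    ((continuous_subtype_val.comp continuous_snd).mul (hphase.comp continuous_fst))

variable [DecidableEq ι]

/-- The inclusion of the circle with index `i`. -/
def wedgePt (i : ι) (w : UnitAddCircle) : Wedge ι :=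
  ⟨fun j => if j = i then w else 0, fun j k h => by grind⟩

@[fun_prop]
theorem continuous_wedgePt (i : ι) : Continuous (wedgePt i) :=
  Continuous.subtype_mk
    (continuous_pi fun _ => continuous_id.if_const _ continuous_const) _

@[simp]
theorem wedgePt_zero (i : ι) : wedgePt i 0 = wedgeBase := Subtype.ext (funext fun _ => ite_self _)

theorem wedgePt_apply_self (i : ι) (w : UnitAddCircle) : (wedgePt i w).1 i = w :=
  if_pos rfl

theorem eq_wedgePt {z : Wedge ι} {i : ι} (hz : z.1 i ≠ 0) : z = wedgePt i (z.1 i) :=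
  Subtype.ext <| funext fun j => by
    obtain rfl | hj := eq_or_ne j i
    · exact (wedgePt_apply_self j _).symm
    · exact ((z.2 j i hj).resolve_right hz).trans (if_neg hj).symm

/-- The loop which runs once along the circle with index `i`. -/
def wedgeLoop (i : ι) : Path (wedgeBase : Wedge ι) wedgeBase where
  toFun t := wedgePt i (t : ℝ)
  continuous_toFun := (continuous_wedgePt i).comp
    ((AddCircle.continuous_mk' 1).comp continuous_subtype_val)
  source' := by simp [wedgePt_zero]
  target' := by simp [AddCircle.coe_period]

/-- The class of `wedgeLoop i`. -/
def wedgeGen (i : ι) : FundamentalGroup (Wedge ι) wedgeBase :=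
  FundamentalGroup.fromPath (.mk (wedgeLoop i))

theorem continuous_wedgePt_coe (i : ι) : Continuous fun a : ℝ => wedgePt i (a : UnitAddCircle) :=
  (continuous_wedgePt i).comp (AddCircle.continuous_mk' 1)

/-- The class of the arc of the circle with index `i` which is the image of the interval from `a`
to `b`, closed up along the shorter arcs to the common point. -/
def arcClass (i : ι) (a b : ℝ) : FundamentalGroup (Wedge ι) wedgeBase :=
  conjLoop wedgeRadius ((Path.segment a b).map (continuous_wedgePt_coe i))

theorem arcClass_trans (i : ι) (a b c : ℝ) :
    arcClass i a c = arcClass i b c * arcClass i a b := by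
  rw [arcClass, arcClass, arcClass, ← conjLoop_trans, ← Path.map_trans]
  exact conjLoop_congr _
    ((SimplyConnectedSpace.paths_homotopic _ _).map ⟨_, continuous_wedgePt_coe i⟩)

theorem conjLoop_map_wedgePt (i : ι) {a b : ℝ} (p : Path a b) :
    conjLoop wedgeRadius (p.map (continuous_wedgePt_coe i)) = arcClass i a b :=
  conjLoop_congr _ ((SimplyConnectedSpace.paths_homotopic _ _).map ⟨_, continuous_wedgePt_coe i⟩)

theorem conjLoop_wedgeRadius_of_ne_zero (i : ι) {y z : Wedge ι} (p : Path y z)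
    (hp : ∀ t, (p t).1 i ≠ 0) :
    conjLoop wedgeRadius p = arcClass i (phase (y.1 i)) (phase (z.1 i)) := by
  let q : Path (phase (y.1 i)) (phase (z.1 i)) :=
    { toFun := fun t => phase ((p t).1 i)
      continuous_toFun := continuous_iff_continuousAt.mpr fun t =>
        (continuousAt_phase (hp t)).comp (f := fun t => (p t).1 i)
          ((continuous_wedge_apply i).comp p.continuous).continuousAt
      source' := by simp
      target' := by simp }
  rw [← conjLoop_map_wedgePt i q]
  refine conjLoop_eq_of_forall _ fun t => ?_
  change p t = wedgePt i (phase ((p t).1 i))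
  rw [coe_phase, ← eq_wedgePt (hp t)]

theorem arcClass_eq_one (i : ι) {n a : ℝ} (hn : (n : UnitAddCircle) = 0)
    (ha : a - n ∈ Set.Ioc (-(1 / 2) : ℝ) (1 / 2)) : arcClass i n a = 1 := by
  rw [← conjLoop_tree wedgeRadius_base (wedgePt i a)]
  refine conjLoop_eq_of_forall _ fun t => Subtype.ext (funext fun j => ?_)
  have hsegment : Path.segment n a t = n + t * (a - n) := by
    simp [Path.segment, AffineMap.lineMap_apply, add_comm]
  change (if j = i then ((Path.segment n a t : ℝ) : UnitAddCircle) else 0) =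
    ((t * signedPhase (if j = i then (a : UnitAddCircle) else 0) : ℝ) : UnitAddCircle)
  split_ifs
  · have hphase : signedPhase a = a - n := by
      rw [← signedPhase_coe ha, AddCircle.coe_sub, hn, sub_zero]
    rw [hsegment, hphase, AddCircle.coe_add, hn, zero_add]
  · simp

theorem arcClass_zero_one (i : ι) : arcClass i 0 1 = wedgeGen i := by
  rw [wedgeGen, ← conjLoop_loop wedgeRadius_base]
  refine conjLoop_eq_of_forall _ fun t => ?_
  change wedgePt i (Path.segment (0 : ℝ) 1 t : ℝ) = wedgePt i (t : ℝ)
  simp [Path.segment, AffineMap.lineMap_apply]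

theorem arcClass_zero_left_mem_closure (i : ι) {a : ℝ} (ha : a ∈ Set.Ico (0 : ℝ) 1) :
    arcClass i 0 a ∈ Subgroup.closure (Set.range (wedgeGen (ι := ι))) := by
  obtain h | h := le_or_gt a (1 / 2)
  · rw [arcClass_eq_one i (n := 0) (by simp) (by constructor <;> linarith [ha.1])]
    exact Subgroup.one_mem _
  · rw [arcClass_trans i 0 1 a, arcClass_zero_one,
      arcClass_eq_one i (AddCircle.coe_period 1) (by constructor <;> linarith [ha.2]), one_mul]
    exact Subgroup.subset_closure ⟨i, rfl⟩

theorem arcClass_mem_closure (i : ι) {a b : ℝ} (ha : a ∈ Set.Ico (0 : ℝ) 1)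
    (hb : b ∈ Set.Ico (0 : ℝ) 1) :
    arcClass i a b ∈ Subgroup.closure (Set.range (wedgeGen (ι := ι))) := by
  rw [← Subgroup.mul_mem_cancel_right _ (arcClass_zero_left_mem_closure i ha), ← arcClass_trans]
  exact arcClass_zero_left_mem_closure i hb

theorem closure_range_wedgeGen [Finite ι] :
    Subgroup.closure (Set.range (wedgeGen (ι := ι))) = ⊤ := by
  refine eq_top_of_locally_conjLoop_mem wedgeRadius_base fun x => ?_
  obtain ⟨o, hx⟩ := exists_mem_wedgeChart x
  refine ⟨wedgeChart o, (isOpen_wedgeChart o).mem_nhds hx, fun y z p hp => ?_⟩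
  cases o with
  | none =>
    rw [conjLoop_wedgeRadius_of_ne_half p fun t => hp ⟨t, rfl⟩]
    exact Subgroup.one_mem _
  | some i =>
    rw [conjLoop_wedgeRadius_of_ne_zero i p fun t => hp ⟨t, rfl⟩]
    exact arcClass_mem_closure i (phase_mem_Ico _) (phase_mem_Ico _)

end Wedge

section ChartCoord

open scoped unitInterval

variable {κ B F : Type*} [TopologicalSpace B] [TopologicalSpace F] (Z : FiberBundleCore κ B F)

/-- The fibre coordinate of a point of a fibre bundle in the chart number `k`. -/
def chartCoord (k : κ) (e : Z.TotalSpace) : F := (Z.localTriv k e).2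

theorem chartCoord_change {k l : κ} {e : Z.TotalSpace} (hk : e.1 ∈ Z.baseSet k)
    (hl : e.1 ∈ Z.baseSet l) : chartCoord Z l e = Z.coordChange k l e.1 (chartCoord Z k e) :=
  (Z.coordChange_comp _ k l e.1 ⟨⟨Z.mem_baseSet_at e.1, hk⟩, hl⟩ e.2).symm

theorem exists_chartCoord_eq {k : κ} {x : B} (hx : x ∈ Z.baseSet k) (v : F) :
    ∃ e : Z.proj ⁻¹' {x}, chartCoord Z k e.1 = v :=
  ⟨⟨(Z.localTriv k).toOpenPartialHomeomorph.symm (x, v), (Z.localTriv k).proj_symm_apply' hx⟩,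
    congrArg Prod.snd ((Z.localTriv k).apply_symm_apply' hx)⟩

theorem chartCoord_eq_of_mem_Icc [DiscreteTopology F] {k : κ} {Γ : I → Z.TotalSpace}
    (hΓ : Continuous Γ) {a b : I} (hab : a ≤ b)
    (hk : ∀ t ∈ Set.Icc a b, (Γ t).1 ∈ Z.baseSet k) :
    chartCoord Z k (Γ b) = chartCoord Z k (Γ a) := by
  have hcoord : ContinuousOn (chartCoord Z k) (Z.proj ⁻¹' Z.baseSet k) :=
    continuous_snd.comp_continuousOn (Z.localTriv k).continuousOn
  exact isPreconnected_Icc.constant (hcoord.comp hΓ.continuousOn hk)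
    (Set.right_mem_Icc.mpr hab) (Set.left_mem_Icc.mpr hab)

end ChartCoord

section WedgeCovering

open scoped unitInterval Topology

variable {ι Q : Type*} (u : ι → Equiv.Perm Q)

/-- The change of coordinates over the circle with index `i`, from the complement of the midpoint
to the complement of the common point. -/
def wedgeTwist (i : ι) (z : Wedge ι) : Equiv.Perm Q :=
  open Classical in if phase (z.1 i) < 1 / 2 then 1 else (u i)⁻¹

theorem eventually_wedgeTwist_eq {i : ι} {z : Wedge ι} (hzero : z.1 i ≠ 0)
    (hhalf : z.1 i ≠ (1 / 2 : ℝ)) : ∀ᶠ y in 𝓝 z, wedgeTwist u i y = wedgeTwist u i z := by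
  have hphase : ContinuousAt (fun y : Wedge ι => phase (y.1 i)) z :=
    (continuousAt_phase hzero).comp (f := fun y : Wedge ι => y.1 i)
      (continuous_wedge_apply i).continuousAt
  have hne : phase (z.1 i) ≠ 1 / 2 := fun h => hhalf (by rw [← h, coe_phase])
  obtain hlt | hgt := hne.lt_or_gt
  · filter_upwards [hphase.eventually_lt_const hlt] with y hy
    rw [wedgeTwist, wedgeTwist, if_pos hy, if_pos hlt]
  · filter_upwards [hphase.eventually_const_lt hgt] with y hy
    rw [wedgeTwist, wedgeTwist, if_neg hy.not_gt, if_neg hgt.not_gt]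

theorem eq_of_mem_wedgeChart {z : Wedge ι} {i j : ι} (hi : z ∈ wedgeChart (some i))
    (hj : z ∈ wedgeChart (some j)) : i = j :=
  by_contra fun h => (z.2 i j h).elim hi hj

/-- The changes of coordinates of the covering of the one-point union of circles in which the
circle with index `i` acts on the fibre by `u i`. -/
def wedgeCoordChange : Option ι → Option ι → Wedge ι → Equiv.Perm Q
  | none, none, _ => 1
  | none, some i, z => wedgeTwist u i z
  | some i, none, z => (wedgeTwist u i z)⁻¹
  | some _, some _, _ => 1

theorem eventually_wedgeCoordChange_eq (k l : Option ι) {z : Wedge ι} (hk : z ∈ wedgeChart k)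
    (hl : z ∈ wedgeChart l) :
    ∀ᶠ y in 𝓝 z, wedgeCoordChange u k l y = wedgeCoordChange u k l z := by
  rcases k with _ | i <;> rcases l with _ | j
  · exact .of_forall fun _ => rfl
  · exact eventually_wedgeTwist_eq u hl (hk j)
  · filter_upwards [eventually_wedgeTwist_eq u hk (hl i)] with y hy
    simp only [wedgeCoordChange, hy]
  · exact .of_forall fun _ => rfl

theorem wedgeCoordChange_mul (k l m : Option ι) {z : Wedge ι} (hk : z ∈ wedgeChart k)
    (hl : z ∈ wedgeChart l) (hm : z ∈ wedgeChart m) :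
    wedgeCoordChange u l m z * wedgeCoordChange u k l z = wedgeCoordChange u k m z := by
  rcases k with _ | i <;> rcases l with _ | j <;> rcases m with _ | n <;>
    simp only [wedgeCoordChange, mul_one, one_mul, inv_mul_cancel]
  · rw [eq_of_mem_wedgeChart hl hm]
  · rw [eq_of_mem_wedgeChart hk hm, mul_inv_cancel]
  · rw [eq_of_mem_wedgeChart hk hl]

theorem wedgePt_mem_wedgeChart_none [DecidableEq ι] (i : ι) {a : ℝ} (ha : a ∈ Set.Icc (0 : ℝ) 1)
    (hhalf : a ≠ 1 / 2) : wedgePt i a ∈ wedgeChart none := by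
  intro j
  by_cases hj : j = i
  · rw [hj, wedgePt_apply_self]
    obtain hlt | rfl := ha.2.lt_or_eq
    · rwa [Ne, AddCircle.coe_eq_coe_iff_of_mem_Ico (a := 0) (by simpa using ⟨ha.1, hlt⟩)
        (by norm_num)]
    · rw [AddCircle.coe_period]
      exact coe_half_ne_zero.symm
  · exact fun h => coe_half_ne_zero (h.symm.trans (if_neg hj))

theorem wedgePt_mem_wedgeChart_some [DecidableEq ι] (i : ι) {a : ℝ} (ha : a ∈ Set.Ioo (0 : ℝ) 1) :
    wedgePt i a ∈ wedgeChart (some i) := fun h => by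
  rw [wedgePt_apply_self] at h
  exact ha.1.ne' ((AddCircle.coe_eq_zero_iff_of_mem_Ico (by simpa using ⟨ha.1.le, ha.2⟩)).mp h)

variable [TopologicalSpace Q] [DiscreteTopology Q]

theorem continuousOn_wedgeCoordChange (k l : Option ι) :
    ContinuousOn (fun p : Wedge ι × Q => wedgeCoordChange u k l p.1 p.2)
      ((wedgeChart k ∩ wedgeChart l) ×ˢ Set.univ) := by
  rintro ⟨z, v⟩ ⟨hz, -⟩
  have hfixed : ContinuousAt (fun p : Wedge ι × Q => wedgeCoordChange u k l z p.2) (z, v) :=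
    (continuous_of_discreteTopology.comp continuous_snd).continuousAt
  refine (hfixed.congr ?_).continuousWithinAt
  filter_upwards [continuousAt_fst.eventually (eventually_wedgeCoordChange_eq u k l hz.1 hz.2)]
    with p hp
  rw [hp]

variable [Finite ι]

/-- The covering of the one-point union of circles with fibre `Q` in which the circle with index
`i` acts on the fibre by `u i`. -/
def wedgeCovering : FiberBundleCore (Option ι) (Wedge ι) Q where
  baseSet := wedgeChart
  isOpen_baseSet := isOpen_wedgeChart
  indexAt z := (exists_mem_wedgeChart z).choose
  mem_baseSet_at z := (exists_mem_wedgeChart z).choose_spec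
  coordChange k l z v := wedgeCoordChange u k l z v
  coordChange_self k z _ v := by cases k <;> rfl
  continuousOn_coordChange := continuousOn_wedgeCoordChange u
  coordChange_comp k l m z hz v := by
    rw [← Equiv.Perm.mul_apply, wedgeCoordChange_mul u k l m hz.1.1 hz.1.2 hz.2]

theorem isCoveringMap_wedgeCovering : IsCoveringMap (wedgeCovering u).proj :=
  FiberBundle.isCoveringMap (F := Q) (E := (wedgeCovering u).Fiber)

variable [DecidableEq ι]

theorem chartCoord_wedgeCovering_lift (i : ι) {Γ : I → (wedgeCovering u).TotalSpace}
    (hΓ : Continuous Γ) (hlift : ∀ t, (Γ t).1 = wedgePt i (t : ℝ)) :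
    chartCoord (wedgeCovering u) none (Γ 1) = u i (chartCoord (wedgeCovering u) none (Γ 0)) := by
  let q : I := ⟨1 / 4, by norm_num⟩
  let r : I := ⟨3 / 4, by norm_num⟩
  have hnone (t : I) (ht : (t : ℝ) ≠ 1 / 2) : (Γ t).1 ∈ wedgeChart none := by
    rw [hlift]
    exact wedgePt_mem_wedgeChart_none i t.2 ht
  have hsome (t : I) (ht : (t : ℝ) ∈ Set.Ioo (0 : ℝ) 1) : (Γ t).1 ∈ wedgeChart (some i) := by
    rw [hlift]
    exact wedgePt_mem_wedgeChart_some i ht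
  have hchange (t : I) (ht : (t : ℝ) ∈ Set.Ioo (0 : ℝ) 1) (hhalf : (t : ℝ) ≠ 1 / 2) :
      chartCoord (wedgeCovering u) (some i) (Γ t) =
        (if (t : ℝ) < 1 / 2 then 1 else (u i)⁻¹) (chartCoord (wedgeCovering u) none (Γ t)) := by
    rw [chartCoord_change (wedgeCovering u) (k := none) (l := some i) (hnone t hhalf) (hsome t ht)]
    change wedgeTwist u i (Γ t).1 _ = _
    rw [wedgeTwist, hlift, wedgePt_apply_self, phase_coe ⟨ht.1.le, ht.2⟩]
  have hq := hchange q (by norm_num [q]) (by norm_num [q])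
  have hr := hchange r (by norm_num [r]) (by norm_num [r])
  rw [if_pos (by norm_num [q]), Equiv.Perm.one_apply] at hq
  rw [if_neg (by norm_num [r]), Equiv.Perm.eq_inv_iff_eq] at hr
  have hstart := chartCoord_eq_of_mem_Icc (wedgeCovering u) hΓ (k := none) (a := 0) (b := q)
    unitInterval.nonneg' fun t ht => hnone t <|
      ne_of_lt (lt_of_le_of_lt (show (t : ℝ) ≤ 1 / 4 from ht.2) (by norm_num))
  have hmiddle := chartCoord_eq_of_mem_Icc (wedgeCovering u) hΓ (k := some i) (a := q) (b := r)
    (Subtype.mk_le_mk.mpr (by norm_num)) fun t ht => hsome t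
      ⟨lt_of_lt_of_le (by norm_num) (show 1 / 4 ≤ (t : ℝ) from ht.1),
        lt_of_le_of_lt (show (t : ℝ) ≤ 3 / 4 from ht.2) (by norm_num)⟩
  have hend := chartCoord_eq_of_mem_Icc (wedgeCovering u) hΓ (k := none) (a := r) (b := 1)
    unitInterval.le_one' fun t ht => hnone t <|
      ne_of_gt (lt_of_lt_of_le (by norm_num) (show 3 / 4 ≤ (t : ℝ) from ht.1))
  rw [hend, ← hr, hmiddle, hq, hstart]

theorem chartCoord_monodromyPerm_lift_wedgeGen (w : FreeGroup ι)
    (e : (wedgeCovering u).proj ⁻¹' {wedgeBase}) :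
    chartCoord (wedgeCovering u) none ((isCoveringMap_wedgeCovering u).monodromyPerm wedgeBase
      (FreeGroup.lift wedgeGen w) e).1 =
      FreeGroup.lift u w (chartCoord (wedgeCovering u) none e.1) := by
  induction w using FreeGroup.induction_on generalizing e with
  | C1 => simp only [map_one, Equiv.Perm.one_apply]
  | of i =>
    rw [FreeGroup.lift_apply_of, FreeGroup.lift_apply_of]
    have hstart : wedgeLoop i 0 = (wedgeCovering u).proj e.1 := (wedgeLoop i).source.trans e.2.symm
    have hcov := isCoveringMap_wedgeCovering u
    have hend := chartCoord_wedgeCovering_lift u i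
      (hcov.liftPath (wedgeLoop i) e.1 hstart).continuous
      (congrFun (hcov.liftPath_lifts (wedgeLoop i) e.1 hstart))
    rwa [hcov.liftPath_zero] at hend
  | inv_of i h =>
    rw [map_inv, map_inv, map_inv, Equiv.Perm.eq_inv_iff_eq, ← h, ← Equiv.Perm.mul_apply,
      mul_inv_cancel, Equiv.Perm.one_apply]
  | mul x y hx hy =>
    rw [map_mul, map_mul, map_mul, Equiv.Perm.mul_apply, Equiv.Perm.mul_apply, hx, hy]

theorem lift_wedgeGen_injective :
    Function.Injective (FreeGroup.lift (wedgeGen (ι := ι))) := by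
  let _ : TopologicalSpace (FreeGroup ι) := ⊥
  have : DiscreteTopology (FreeGroup ι) := ⟨rfl⟩
  let u : ι → Equiv.Perm (FreeGroup ι) := fun i => Equiv.mulLeft (FreeGroup.of i)
  have hu : FreeGroup.lift u = MulAction.toPermHom (FreeGroup ι) (FreeGroup ι) :=
    FreeGroup.ext_hom _ _ fun i => FreeGroup.lift_apply_of
  refine (injective_iff_map_eq_one _).mpr fun w hw => ?_
  obtain ⟨e, he⟩ := exists_chartCoord_eq (wedgeCovering u) (k := none) (x := wedgeBase)
    (fun _ => coe_half_ne_zero.symm) 1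
  have h := chartCoord_monodromyPerm_lift_wedgeGen u w e
  rw [hw, map_one, Equiv.Perm.one_apply, he, hu] at h
  simpa using h.symm

end WedgeCovering

section WedgeLift

open scoped unitInterval

variable {X ι : Type*} {x₀ : X} [TopologicalSpace X]

/-- The map from the circle to a space given by a loop. -/
def circleLift (p : Path x₀ x₀) : UnitAddCircle → X := AddCircle.liftIco 1 0 p.extend

theorem circleLift_coe (p : Path x₀ x₀) (t : I) : circleLift p (t : ℝ) = p t := by
  obtain ht | ht := t.2.2.lt_or_eq
  · exact (AddCircle.liftIco_zero_coe_apply ⟨t.2.1, ht⟩).trans (p.extend_apply t.2)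
  · obtain rfl : t = 1 := Subtype.ext ht
    rw [Set.Icc.coe_one, AddCircle.coe_period, ← QuotientAddGroup.mk_zero]
    exact (AddCircle.liftIco_zero_coe_apply (by norm_num)).trans (by simp)

theorem circleLift_zero (p : Path x₀ x₀) : circleLift p 0 = x₀ := by
  simpa using circleLift_coe p 0

theorem continuous_circleLift (p : Path x₀ x₀) : Continuous (circleLift p) :=
  AddCircle.liftIco_zero_continuous (by simp) p.continuous_extend.continuousOn

open Classical in
/-- The value at `z` of the map from a one-point union of circles given by a family of loops. -/
def wedgeLiftFun (p : ι → Path x₀ x₀) (z : Wedge ι) : X :=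
  if h : ∃ i, z.1 i ≠ 0 then circleLift (p h.choose) (z.1 h.choose) else x₀

theorem wedgeLiftFun_base (p : ι → Path x₀ x₀) : wedgeLiftFun p wedgeBase = x₀ :=
  dif_neg fun ⟨_, hi⟩ => hi rfl

theorem wedgeLiftFun_eq_circleLift (p : ι → Path x₀ x₀) {z : Wedge ι} {i : ι}
    (hz : ∀ j, j ≠ i → z.1 j = 0) : wedgeLiftFun p z = circleLift (p i) (z.1 i) := by
  by_cases h : ∃ j, z.1 j ≠ 0
  · obtain hi : h.choose = i := not_imp_comm.mp (hz _) h.choose_spec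
    rw [wedgeLiftFun, dif_pos h, hi]
  · rw [wedgeLiftFun, dif_neg h, not_not.mp (not_exists.mp h i), circleLift_zero]

theorem continuous_wedgeLiftFun [Finite ι] (p : ι → Path x₀ x₀) :
    Continuous (wedgeLiftFun p) := by
  let axis : Option ι → Set (Wedge ι)
    | none => {wedgeBase}
    | some i => {z | ∀ j, j ≠ i → z.1 j = 0}
  have hcover : ⋃ o, axis o = Set.univ := Set.eq_univ_of_forall fun z => Set.mem_iUnion.mpr <| by
    by_cases h : ∃ i, z.1 i ≠ 0
    · obtain ⟨i, hi⟩ := h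
      exact ⟨some i, fun j hj => (z.2 j i hj).resolve_right hi⟩
    · exact ⟨none, Subtype.ext (funext fun i => not_not.mp (not_exists.mp h i))⟩
  refine (locallyFinite_of_finite axis).continuous hcover (fun o => ?_) fun o => ?_
  · cases o with
    | none => exact isClosed_singleton
    | some i =>
      simp only [axis, Set.ofPred_forall]
      exact isClosed_iInter fun j => isClosed_iInter fun _ =>
        isClosed_eq (continuous_wedge_apply j) continuous_const
  · cases o with
    | none => exact continuousOn_singleton _ _
    | some i =>
      exact ((continuous_circleLift (p i)).comp (continuous_wedge_apply i)).continuousOn.congr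
        fun z hz => wedgeLiftFun_eq_circleLift p hz

/-- The map from a one-point union of circles given by a family of loops. -/
def wedgeLift [Finite ι] (p : ι → Path x₀ x₀) : C(Wedge ι, X) :=
  ⟨wedgeLiftFun p, continuous_wedgeLiftFun p⟩

theorem wedgeLift_base [Finite ι] (p : ι → Path x₀ x₀) : wedgeLift p wedgeBase = x₀ :=
  wedgeLiftFun_base p

theorem wedgeLift_wedgePt [Finite ι] [DecidableEq ι] (p : ι → Path x₀ x₀) (i : ι) (t : I) :
    wedgeLift p (wedgePt i (t : ℝ)) = p i t := by
  refine (wedgeLiftFun_eq_circleLift p fun j hj => if_neg hj).trans ?_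
  rw [wedgePt_apply_self, circleLift_coe]

end WedgeLift

section Homotopy

variable {X Y : Type*} [TopologicalSpace X] [TopologicalSpace Y] {x : X} {y : Y}

theorem mapOfEq_mapOfEq_of_homotopyRel {f : C(X, Y)} {h : C(Y, X)} (hf : f x = y) (hh : h y = x)
    (H : (ContinuousMap.id X).HomotopyRel (h.comp f) {x}) (c : FundamentalGroup X x) :
    FundamentalGroup.mapOfEq h hh (FundamentalGroup.mapOfEq f hf c) = c := by
  induction c using Quotient.inductionOn with | h p =>
  change FundamentalGroup.mapOfEq h hh
    (FundamentalGroup.mapOfEq f hf (FundamentalGroup.fromPath (.mk p))) = _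
  rw [FundamentalGroup.mapOfEq_apply, FundamentalGroup.mapOfEq_apply]
  refine Quotient.sound (Path.Homotopic.symm ⟨?_⟩)
  exact
    { toFun := fun q => H (q.1, p q.2)
      continuous_toFun := by fun_prop
      map_zero_left := fun t => H.apply_zero (p t)
      map_one_left := fun t => H.apply_one (p t)
      prop' := by
        rintro t s (rfl | rfl)
        · exact H.eq_fst t (p.source : p 0 = x)
        · exact H.eq_fst t (p.target : p 1 = x) }

end Homotopy

section Sides

open scoped unitInterval

variable {g : ℕ}

/-- The side loops `α_i` and `β_i`. -/
def sideLoop : Fin g ⊕ Fin g → Path (basept g) (basept g) :=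
  Sum.elim (alphaLoop g) (betaLoop g)

/-- The number of the first of the two sides that are glued to a side loop; the second one
follows two sides later. -/
def sideNumber : Fin g ⊕ Fin g → ℕ :=
  Sum.elim (fun i => 4 * i) fun i => 4 * i + 1

theorem sideNumber_add_two_lt (j : Fin g ⊕ Fin g) : sideNumber j + 2 < 4 * g := by
  rcases j with i | i <;> simp only [sideNumber, Sum.elim_inl, Sum.elim_inr] <;> omega

theorem exists_sideNumber {k : ℕ} (hk : k < 4 * g) :
    ∃ j : Fin g ⊕ Fin g, k = sideNumber j ∨ k = sideNumber j + 2 := by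
  obtain h | h : k % 2 = 0 ∨ k % 2 = 1 := by omega
  · exact ⟨.inl ⟨k / 4, by omega⟩, by simp only [sideNumber, Sum.elim_inl]; omega⟩
  · exact ⟨.inr ⟨k / 4, by omega⟩, by simp only [sideNumber, Sum.elim_inr]; omega⟩

theorem sideNumber_unique {j j' : Fin g ⊕ Fin g} {k : ℤ}
    (h : k = sideNumber j ∨ k = sideNumber j + 2)
    (h' : k = sideNumber j' ∨ k = sideNumber j' + 2) : j = j' := by
  rcases j with i | i <;> rcases j' with i' | i' <;>
    simp only [sideNumber, Sum.elim_inl, Sum.elim_inr] at h h'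
  · exact congrArg _ (Fin.ext (by omega))
  · omega
  · omega
  · exact congrArg _ (Fin.ext (by omega))

theorem toSurface_sidePoint_sideNumber (j : Fin g ⊕ Fin g) (t : I) :
    toSurface g (sidePoint g (sideNumber j) t) = sideLoop j t := by
  cases j <;> rfl

theorem sideRel_sideNumber (j : Fin g ⊕ Fin g) (t : I) :
    SideRel g (sidePoint g (sideNumber j) t) (sidePoint g (sideNumber j + 2) (σ t)) := by
  cases j with
  | inl i => exact .alpha i t
  | inr i => exact .beta i t

theorem exists_sidePoint_of_sideRel {z w : Disc} (h : SideRel g z w) :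
    ∃ (j : Fin g ⊕ Fin g) (t : I),
      z = sidePoint g (sideNumber j) t ∧ w = sidePoint g (sideNumber j + 2) (σ t) := by
  cases h with
  | alpha i t => exact ⟨.inl i, t, rfl, rfl⟩
  | beta i t => exact ⟨.inr i, t, rfl, rfl⟩

theorem toSurface_sidePoint_sideNumber_add_two (j : Fin g ⊕ Fin g) (t : I) :
    toSurface g (sidePoint g (sideNumber j + 2) t) = sideLoop j (σ t) := by
  have hglue : toSurface g _ = toSurface g _ := Quot.sound (sideRel_sideNumber j (σ t))
  rw [← toSurface_sidePoint_sideNumber, hglue, unitInterval.symm_symm]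

end Sides

section Retraction

open scoped unitInterval

/-- The point at position `s` on the boundary of the polygon, each side having length one. -/
def circlePt (g : ℕ) (s : ℝ) : Disc :=
  ⟨(Circle.exp (2 * Real.pi * (s / (4 * g + 1))) : ℂ), by
    rw [mem_closedBall_zero_iff, Circle.norm_coe]⟩

theorem sidePoint_eq_circlePt (g k : ℕ) (t : I) : sidePoint g k t = circlePt g (k + t) := rfl

@[fun_prop]
theorem continuous_circlePt (g : ℕ) : Continuous (circlePt g) := by
  unfold circlePt
  fun_prop

theorem injOn_circlePt (g : ℕ) : Set.InjOn (circlePt g) (Set.Icc 0 (4 * g)) := by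
  have hpos : (0 : ℝ) < 4 * g + 1 := by positivity
  have hmem {s : ℝ} (hs : s ∈ Set.Icc (0 : ℝ) (4 * g)) :
      s / (4 * g + 1) ∈ Set.Ico (0 : ℝ) (0 + 1) :=
    ⟨div_nonneg hs.1 hpos.le, by rw [div_lt_iff₀ hpos]; linarith [hs.2]⟩
  intro s hs s' hs' h
  have hexp : AddCircle.toCircle ((s / (4 * g + 1) : ℝ) : UnitAddCircle) =
      AddCircle.toCircle ((s' / (4 * g + 1) : ℝ) : UnitAddCircle) := by
    rw [AddCircle.toCircle_apply_mk, AddCircle.toCircle_apply_mk, div_one]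
    exact Subtype.ext (congrArg (Subtype.val : Disc → ℂ) h)
  exact (div_left_inj' hpos.ne').mp <| (AddCircle.coe_eq_coe_iff_of_mem_Ico (hmem hs)
    (hmem hs')).mp (AddCircle.injective_toCircle one_ne_zero hexp)

theorem exists_discRetraction (g : ℕ) : ∃ r : C(Disc, ℝ), (∀ z, r z ∈ Set.Icc (0 : ℝ) (4 * g)) ∧
    ∀ s ∈ Set.Icc (0 : ℝ) (4 * g), r (circlePt g s) = s := by
  let arc : Set.Icc (0 : ℝ) (4 * g) → Disc := fun s => circlePt g s
  have harc : Topology.IsClosedEmbedding arc :=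
    Continuous.isClosedEmbedding (by fun_prop) fun s s' h =>
      Subtype.ext (injOn_circlePt g s.2 s'.2 h)
  obtain ⟨r, hr, hrarc⟩ := ContinuousMap.exists_extension_forall_mem_of_isClosedEmbedding
    (⟨Subtype.val, continuous_subtype_val⟩ : C(Set.Icc (0 : ℝ) (4 * g), ℝ))
    (t := Set.Icc (0 : ℝ) (4 * g)) (fun s => s.2) (Set.nonempty_Icc.mpr (by positivity)) harc
  exact ⟨r, hr, fun s hs => congrFun hrarc ⟨s, hs⟩⟩

/-- A retraction of the polygon onto the union of its glued sides, given as a position on the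
boundary; it exists because the free side is open in the boundary circle. -/
def discRetraction (g : ℕ) : C(Disc, ℝ) := (exists_discRetraction g).choose

theorem discRetraction_mem (g : ℕ) (z : Disc) : discRetraction g z ∈ Set.Icc (0 : ℝ) (4 * g) :=
  (exists_discRetraction g).choose_spec.1 z

theorem discRetraction_circlePt (g : ℕ) {s : ℝ} (hs : s ∈ Set.Icc (0 : ℝ) (4 * g)) :
    discRetraction g (circlePt g s) = s :=
  (exists_discRetraction g).choose_spec.2 s hs

theorem discRetraction_sidePoint (g : ℕ) {k : ℕ} (hk : k < 4 * g) (t : I) :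
    discRetraction g (sidePoint g k t) = k + t := by
  have hk' : (k : ℝ) + 1 ≤ 4 * g := by exact_mod_cast hk
  exact discRetraction_circlePt g ⟨by linarith [t.2.1, k.cast_nonneg (α := ℝ)],
    by linarith [t.2.2]⟩

theorem discRetraction_sidePoint_zero (g : ℕ) : discRetraction g (sidePoint g 0 0) = 0 := by
  rw [sidePoint_eq_circlePt, Nat.cast_zero, Set.Icc.coe_zero, add_zero]
  exact discRetraction_circlePt g (Set.left_mem_Icc.mpr (by positivity))

/-- The position on a circle of a point that moves along the boundary of the polygon: it runs
forwards around the circle during side `m`, backwards during side `m + 2`, and rests otherwise. -/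
def sidePos (m : ℤ) (s : ℝ) : ℝ := max 0 (min 1 (min (s - m) (m + 3 - s)))

theorem coe_sidePos (m k : ℤ) {t : ℝ} (ht : t ∈ Set.Icc (0 : ℝ) 1) :
    (sidePos m (k + t) : UnitAddCircle) =
      ((if k = m then t else if k = m + 2 then 1 - t else 0 : ℝ) : UnitAddCircle) := by
  obtain ⟨h0, h1⟩ := ht
  obtain h | rfl | rfl | rfl | h : k + 1 ≤ m ∨ k = m ∨ k = m + 1 ∨ k = m + 2 ∨ m + 3 ≤ k := by
    omega
  · have h' : (k : ℝ) + 1 ≤ m := by exact_mod_cast h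
    rw [if_neg (by omega), if_neg (by omega), sidePos, max_eq_left]
    exact (min_le_right _ _).trans ((min_le_left _ _).trans (by linarith))
  · rw [if_pos rfl, sidePos, min_eq_left (a := k + t - k) (by linarith),
      min_eq_right (by linarith), max_eq_right (by linarith), add_sub_cancel_left]
  · rw [if_neg (by omega), if_neg (by omega), sidePos, min_eq_left, max_eq_right zero_le_one,
      AddCircle.coe_period, AddCircle.coe_zero]
    push_cast
    exact le_min (by linarith) (by linarith)
  · rw [if_neg (by omega), if_pos rfl, sidePos]
    push_cast
    rw [min_eq_right (b := (m : ℝ) + 3 - (m + 2 + t)) (by linarith), min_eq_right (by linarith),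
      max_eq_right (by linarith)]
    congr 1
    ring
  · have h' : (m : ℝ) + 3 ≤ k := by exact_mod_cast h
    rw [if_neg (by omega), if_neg (by omega), sidePos, max_eq_left]
    exact (min_le_right _ _).trans ((min_le_right _ _).trans (by linarith))

theorem floor_eq_of_coe_sidePos_ne_zero {m : ℤ} {s : ℝ} (h : (sidePos m s : UnitAddCircle) ≠ 0) :
    ⌊s⌋ = m ∨ ⌊s⌋ = m + 2 := by
  by_contra hfloor
  rw [← Int.floor_add_fract s,
    coe_sidePos _ _ ⟨Int.fract_nonneg s, (Int.fract_lt_one s).le⟩] at h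
  rw [not_or] at hfloor
  rw [if_neg hfloor.1, if_neg hfloor.2] at h
  exact h (AddCircle.coe_zero 1)

/-- The map from the boundary of the polygon to the one-point union of circles that sends every
glued side around its circle. -/
def edgeMap (g : ℕ) (s : ℝ) : Wedge (Fin g ⊕ Fin g) :=
  ⟨fun j => sidePos (sideNumber j) s, fun j j' hne => by
    by_contra! hcoord
    exact hne (sideNumber_unique (floor_eq_of_coe_sidePos_ne_zero hcoord.1)
      (floor_eq_of_coe_sidePos_ne_zero hcoord.2))⟩

@[fun_prop]
theorem continuous_edgeMap (g : ℕ) : Continuous (edgeMap g) := by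
  unfold edgeMap sidePos
  exact Continuous.subtype_mk (continuous_pi fun j =>
    (AddCircle.continuous_mk' 1).comp (by fun_prop)) _

variable {g : ℕ}

theorem edgeMap_apply (k : ℤ) (t : I) (j : Fin g ⊕ Fin g) :
    (edgeMap g (k + t)).1 j =
      ((if k = sideNumber j then (t : ℝ) else if k = sideNumber j + 2 then 1 - (t : ℝ) else 0 : ℝ) :
        UnitAddCircle) :=
  coe_sidePos _ _ t.2

theorem edgeMap_sideNumber_add (j : Fin g ⊕ Fin g) (t : I) :
    edgeMap g (sideNumber j + t) = wedgePt j (t : ℝ) := by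
  refine Subtype.ext (funext fun j' => ?_)
  rw [← Int.cast_natCast (sideNumber j), edgeMap_apply]
  by_cases hj : j' = j
  · rw [hj, if_pos rfl, wedgePt_apply_self]
  · rw [if_neg fun h => hj (sideNumber_unique (.inl h) (.inl rfl)),
      if_neg fun h => hj (sideNumber_unique (.inr h) (.inl rfl))]
    exact (if_neg hj).symm

theorem edgeMap_sideNumber_add_two_add (j : Fin g ⊕ Fin g) (t : I) :
    edgeMap g ((sideNumber j + 2 : ℕ) + t) = wedgePt j (σ t : ℝ) := by
  refine Subtype.ext (funext fun j' => ?_)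
  rw [← Int.cast_natCast (sideNumber j + 2), edgeMap_apply, Nat.cast_add, Nat.cast_ofNat]
  by_cases hj : j' = j
  · rw [hj, if_neg (by omega), if_pos rfl, wedgePt_apply_self, unitInterval.coe_symm_eq]
  · rw [if_neg fun h => hj (sideNumber_unique (.inl h) (.inr rfl)),
      if_neg fun h => hj (sideNumber_unique (.inr h) (.inr rfl))]
    exact (if_neg hj).symm

theorem edgeMap_intCast (k : ℤ) : edgeMap g k = wedgeBase := by
  refine Subtype.ext (funext fun j => ?_)
  have hk := edgeMap_apply (g := g) k 0 j
  rw [Set.Icc.coe_zero, add_zero] at hk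
  rw [hk]
  split_ifs <;> simp [wedgeBase, AddCircle.coe_period]

theorem edgeMap_discRetraction_eq_of_sideRel {z w : Disc} (h : SideRel g z w) :
    edgeMap g (discRetraction g z) = edgeMap g (discRetraction g w) := by
  obtain ⟨j, t, rfl, rfl⟩ := exists_sidePoint_of_sideRel h
  have hj := sideNumber_add_two_lt j
  rw [discRetraction_sidePoint g (by omega), discRetraction_sidePoint g hj,
    edgeMap_sideNumber_add, edgeMap_sideNumber_add_two_add, unitInterval.symm_symm]

/-- The retraction of the surface onto the one-point union of the side loops. -/
def toWedge (g : ℕ) : C(Surface g, Wedge (Fin g ⊕ Fin g)) where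
  toFun := Quot.lift (fun z => edgeMap g (discRetraction g z))
    fun _ _ => edgeMap_discRetraction_eq_of_sideRel
  continuous_toFun := continuous_quot_lift _ (by fun_prop)

theorem toWedge_toSurface (z : Disc) :
    toWedge g (toSurface g z) = edgeMap g (discRetraction g z) := rfl

theorem toWedge_basept : toWedge g (basept g) = wedgeBase := by
  rw [basept, toWedge_toSurface, discRetraction_sidePoint_zero, ← Int.cast_zero, edgeMap_intCast]

theorem toWedge_sideLoop (j : Fin g ⊕ Fin g) (t : I) :
    toWedge g (sideLoop j t) = wedgeLoop j t := by
  have hj := sideNumber_add_two_lt j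
  rw [← toSurface_sidePoint_sideNumber, toWedge_toSurface, discRetraction_sidePoint g (by omega),
    edgeMap_sideNumber_add]
  rfl

theorem wedgeLift_sideLoop_edgeMap {s : ℝ} (hs : s ∈ Set.Icc (0 : ℝ) (4 * g)) :
    wedgeLift sideLoop (edgeMap g s) = toSurface g (circlePt g s) := by
  obtain hlt | rfl := hs.2.lt_or_eq
  · let t : I := ⟨s - ⌊s⌋₊, by linarith [Nat.floor_le hs.1], by linarith [Nat.lt_floor_add_one s]⟩
    have hst : s = ⌊s⌋₊ + t := (add_sub_cancel _ s).symm
    have hk : ⌊s⌋₊ < 4 * g := by rw [Nat.floor_lt hs.1]; exact_mod_cast hlt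
    rw [hst, ← sidePoint_eq_circlePt]
    generalize ⌊s⌋₊ = k at hk
    obtain ⟨j, rfl | rfl⟩ := exists_sideNumber hk
    · rw [edgeMap_sideNumber_add, wedgeLift_wedgePt, toSurface_sidePoint_sideNumber]
    · rw [edgeMap_sideNumber_add_two_add, wedgeLift_wedgePt,
        toSurface_sidePoint_sideNumber_add_two]
  · have hvertex := vertex_four_mul g g le_rfl
    rw [sidePoint_eq_circlePt, Set.Icc.coe_zero, add_zero] at hvertex
    push_cast at hvertex
    have hbase : edgeMap g (4 * g) = wedgeBase := by exact_mod_cast edgeMap_intCast (4 * g)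
    rw [hvertex, hbase, wedgeLift_base]

end Retraction

section Deformation

open scoped unitInterval

/-- The point at time `t` on the segment from `z` to `w` in the disc. -/
def discSegment (z w : Disc) (t : I) : Disc :=
  ⟨AffineMap.lineMap (z : ℂ) (w : ℂ) (t : ℝ), (convex_closedBall 0 1).lineMap_mem z.2 w.2 t.2⟩

theorem discSegment_self (z : Disc) (t : I) : discSegment z z t = z :=
  Subtype.ext (AffineMap.lineMap_same_apply _ _)

variable {g : ℕ}

/-- The position at time `t` of a point of the surface in the deformation retraction to the side
loops, which moves every point of the polygon straight to its image under the retraction. -/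
def deform (t : I) : Surface g → Surface g :=
  Quot.lift (fun z => toSurface g (discSegment z (circlePt g (discRetraction g z)) t)) <| by
    intro z w h
    obtain ⟨j, a, rfl, rfl⟩ := exists_sidePoint_of_sideRel h
    have hj := sideNumber_add_two_lt j
    rw [discRetraction_sidePoint g (by omega), discRetraction_sidePoint g hj,
      ← sidePoint_eq_circlePt, ← sidePoint_eq_circlePt, discSegment_self, discSegment_self]
    exact Quot.sound h

theorem continuous_deform : Continuous fun p : I × Surface g => deform p.1 p.2 := by
  refine isQuotientMap_quot_mk.continuous_lift_prod_right (f := toSurface g) ?_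
  change Continuous fun p : I × Disc =>
    toSurface g (discSegment p.2 (circlePt g (discRetraction g p.2)) p.1)
  refine (continuous_toSurface g).comp ?_
  unfold discSegment
  fun_prop

theorem deform_zero (x : Surface g) : deform 0 x = x := by
  induction x using Quot.ind with | mk z =>
  exact congrArg (toSurface g) (Subtype.ext (AffineMap.lineMap_apply_zero _ _))

theorem deform_one (x : Surface g) : deform 1 x = wedgeLift sideLoop (toWedge g x) := by
  induction x using Quot.ind with | mk z =>
  exact (congrArg (toSurface g) (Subtype.ext (AffineMap.lineMap_apply_one _ _))).trans
    (wedgeLift_sideLoop_edgeMap (discRetraction_mem g z)).symm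

theorem deform_basept (t : I) : deform t (basept g) = basept g := by
  have hpos : circlePt g 0 = sidePoint g 0 0 := by simp [sidePoint_eq_circlePt]
  change toSurface g _ = toSurface g _
  rw [discRetraction_sidePoint_zero, hpos, discSegment_self]

/-- The deformation retraction of the surface to the side loops, as a homotopy. -/
def deformHomotopy : (ContinuousMap.id (Surface g)).HomotopyRel
    ((wedgeLift sideLoop).comp (toWedge g)) {basept g} where
  toFun p := deform p.1 p.2
  continuous_toFun := continuous_deform
  map_zero_left := deform_zero
  map_one_left := deform_one
  prop' := by
    rintro t _ rfl
    exact deform_basept t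

/-- The homomorphism from `π` to the fundamental group of the one-point union of circles induced
by the retraction. -/
def pi1ToWedge : Pi1 g →* FundamentalGroup (Wedge (Fin g ⊕ Fin g)) wedgeBase :=
  FundamentalGroup.mapOfEq (toWedge g) toWedge_basept

theorem pi1ToWedge_injective : Function.Injective (pi1ToWedge (g := g)) :=
  Function.LeftInverse.injective
    (mapOfEq_mapOfEq_of_homotopyRel toWedge_basept (wedgeLift_base sideLoop) deformHomotopy)

theorem pi1ToWedge_loopClass_sideLoop (j : Fin g ⊕ Fin g) :
    pi1ToWedge (loopClass (sideLoop j)) = wedgeGen j :=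
  (FundamentalGroup.mapOfEq_apply _ _ _).trans <|
    congrArg (fun p => FundamentalGroup.fromPath (.mk p)) <|
      Path.ext (funext (toWedge_sideLoop j))

theorem lift_loopClass_sideLoop_bijective :
    Function.Bijective (FreeGroup.lift fun j : Fin g ⊕ Fin g => loopClass (sideLoop j)) := by
  have hcomp : pi1ToWedge.comp (FreeGroup.lift fun j : Fin g ⊕ Fin g => loopClass (sideLoop j)) =
      FreeGroup.lift wedgeGen := by
    ext j
    simpa using pi1ToWedge_loopClass_sideLoop j
  constructor
  · have hinj := lift_wedgeGen_injective (ι := Fin g ⊕ Fin g)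
    rw [← hcomp, MonoidHom.coe_comp] at hinj
    exact hinj.of_comp
  · have hsurj : Function.Surjective (FreeGroup.lift (wedgeGen (ι := Fin g ⊕ Fin g))) := by
      rw [← MonoidHom.range_eq_top, FreeGroup.range_lift_eq_closure, closure_range_wedgeGen]
    rw [← hcomp, MonoidHom.coe_comp] at hsurj
    exact hsurj.of_comp_left pi1ToWedge_injective

/-- The side loops form a basis of the free group `π`. -/
def pi1Basis (g : ℕ) : FreeGroupBasis (Fin g ⊕ Fin g) (Pi1 g) :=
  .ofRepr (MulEquiv.ofBijective _ lift_loopClass_sideLoop_bijective).symm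

theorem pi1Basis_apply (j : Fin g ⊕ Fin g) : pi1Basis g j = loopClass (sideLoop j) :=
  FreeGroup.lift_apply_of (f := fun j => loopClass (sideLoop j))

end Deformation

section TensorHom

/-- The identification of `V ⊗ L` with `Hom(V, L)`, `y ⊗ κ ↦ ω(y, ·) κ`, given by a nondegenerate
bilinear form `ω` on `V`. -/
def tensorHomEquiv {K V L : Type*} [Field K] [AddCommGroup V] [Module K V] [FiniteDimensional K V]
    [AddCommGroup L] [Module K L] (ω : LinearMap.BilinForm K V) (hω : ω.Nondegenerate) :
    V ⊗[K] L ≃ₗ[K] V →ₗ[K] L :=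
  (TensorProduct.congr (ω.toDual hω) (.refl K L)).trans (dualTensorHomEquiv K V L)

variable {V L : Type} [AddCommGroup V] [Module ℚ V] [AddCommGroup L] [Module ℚ L]
  (ω : LinearMap.BilinForm ℚ V)

theorem contract_tmul (h y : V) (κ : L) : contract ω h (y ⊗ₜ[ℚ] κ) = ω y h • κ := by
  simp [contract]

theorem tensorHomEquiv_apply_apply [FiniteDimensional ℚ V] (hω : ω.Nondegenerate)
    (t : V ⊗[ℚ] L) (h : V) : tensorHomEquiv ω hω t h = contract ω h t := by
  induction t with
  | zero => simp only [map_zero, LinearMap.zero_apply]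
  | add s t hs ht => rw [map_add, LinearMap.add_apply, hs, ht, map_add]
  | tmul y κ =>
    simp [tensorHomEquiv, contract_tmul, dualTensorHomEquiv, LinearMap.BilinForm.toDual_def]

end TensorHom

section Homology

variable {g : ℕ}

theorem hclass_mul (x y : Pi1 g) : hclass (x * y) = hclass x + hclass y := by
  rw [hclass, map_mul, ofMul_mul, TensorProduct.tmul_add]
  rfl

theorem hclass_inv (x : Pi1 g) : hclass x⁻¹ = -hclass x := by
  rw [hclass, map_inv, ofMul_inv, TensorProduct.tmul_neg]
  rfl

/-- The linear map on `H` induced by a homomorphism from `π` to a rational vector space. -/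
def liftHomology {M : Type*} [AddCommGroup M] [Module ℚ M] (φ : Pi1 g →* Multiplicative M) :
    H1 g →ₗ[ℚ] M :=
  LinearMap.liftBaseChange ℚ
    (MonoidHom.toAdditiveLeft (Abelianization.lift φ)).toIntLinearMap

theorem liftHomology_hclass {M : Type*} [AddCommGroup M] [Module ℚ M]
    (φ : Pi1 g →* Multiplicative M) (x : Pi1 g) : liftHomology φ (hclass x) = (φ x).toAdd := by
  simp [liftHomology, hclass]

variable (g) in
/-- The homology classes of the side loops as a basis of `H`. -/
def homologyBasis : Module.Basis (Fin g ⊕ Fin g) ℚ (H1 g) :=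
  ((FreeAbelianGroup.basis _).map (AddEquiv.toIntLinearEquiv
    (MulEquiv.toAdditive (pi1Basis g).repr.symm.abelianizationCongr))).baseChange ℚ

theorem homologyBasis_apply (j : Fin g ⊕ Fin g) :
    homologyBasis g j = hclass (loopClass (sideLoop j)) := by
  have h : FreeAbelianGroup.basis (Fin g ⊕ Fin g) j = FreeAbelianGroup.of j := by
    rw [Module.Basis.apply_eq_iff]
    exact FreeAbelianGroup.toFinsupp_of j
  rw [homologyBasis, Module.Basis.baseChange_apply, Module.Basis.map_apply, h,
    ← pi1Basis_apply]
  rfl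

instance : FiniteDimensional ℚ (H1 g) := .of_basis (homologyBasis g)

theorem IsIntersectionForm.toMatrix_eq {ω : LinearMap.BilinForm ℚ (H1 g)}
    (h : IsIntersectionForm g ω) :
    LinearMap.BilinForm.toMatrix (homologyBasis g) ω = (Matrix.J (Fin g) ℚ)ᵀ := by
  ext (i | i) (j | j) <;>
    rw [LinearMap.BilinForm.toMatrix_apply, homologyBasis_apply, homologyBasis_apply]
  · simpa [Matrix.J, sideLoop] using h.alpha_alpha i j
  · simpa [Matrix.J, sideLoop, Matrix.one_apply, eq_comm] using h.alpha_beta i j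
  · rw [← h.alt.neg_eq]
    simpa [Matrix.J, sideLoop, Matrix.one_apply] using h.alpha_beta j i
  · simpa [Matrix.J, sideLoop] using h.beta_beta i j

theorem isIntersectionForm_iff {ω : LinearMap.BilinForm ℚ (H1 g)} :
    IsIntersectionForm g ω ↔
      LinearMap.BilinForm.toMatrix (homologyBasis g) ω = (Matrix.J (Fin g) ℚ)ᵀ := by
  refine ⟨IsIntersectionForm.toMatrix_eq, fun h => ?_⟩
  have hentry (j k : Fin g ⊕ Fin g) : ω (homologyBasis g j) (homologyBasis g k) =
      (Matrix.J (Fin g) ℚ)ᵀ j k := by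
    rw [← h, LinearMap.BilinForm.toMatrix_apply]
  have hskew : ω = -ω.flip := by
    refine (homologyBasis g).ext fun j => (homologyBasis g).ext fun k => ?_
    rw [LinearMap.neg_apply, LinearMap.neg_apply, LinearMap.BilinForm.flip_apply, hentry, hentry,
      Matrix.J_transpose, Matrix.neg_apply, ← Matrix.J_transpose, Matrix.transpose_apply]
  refine ⟨LinearMap.isAlt_iff_eq_neg_flip.2 hskew, fun i j => ?_, fun i j => ?_, fun i j => ?_⟩
  · simpa [Matrix.J, sideLoop, homologyBasis_apply] using hentry (.inl i) (.inl j)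
  · simpa [Matrix.J, sideLoop, homologyBasis_apply] using hentry (.inr i) (.inr j)
  · simpa [Matrix.J, sideLoop, homologyBasis_apply, Matrix.one_apply, eq_comm] using
      hentry (.inl i) (.inr j)

theorem existsUnique_intersectionForm (g : ℕ) : ∃! ω, IsIntersectionForm g ω := by
  simp only [isIntersectionForm_iff]
  exact (LinearMap.BilinForm.toMatrix (homologyBasis g)).bijective.existsUnique _

theorem IsIntersectionForm.nondegenerate {ω : LinearMap.BilinForm ℚ (H1 g)}
    (h : IsIntersectionForm g ω) : ω.Nondegenerate :=
  LinearMap.BilinForm.nondegenerate_of_det_ne_zero ω (homologyBasis g) (by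
    rw [h.toMatrix_eq, Matrix.det_transpose]
    exact (Matrix.isUnit_det_J _ _).ne_zero)

theorem IsIntersectionForm.sum_tmul_contract {ω : LinearMap.BilinForm ℚ (H1 g)}
    (h : IsIntersectionForm g ω) {L : Type} [AddCommGroup L] [Module ℚ L] (t : H1 g ⊗[ℚ] L) :
    ∑ i, (hclass (loopClass (alphaLoop g i)) ⊗ₜ[ℚ]
        contract ω (hclass (loopClass (betaLoop g i))) t -
      hclass (loopClass (betaLoop g i)) ⊗ₜ[ℚ]
        contract ω (hclass (loopClass (alphaLoop g i))) t) = t := by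
  refine (tensorHomEquiv ω h.nondegenerate).injective ((homologyBasis g).ext ?_)
  intro k
  rw [tensorHomEquiv_apply_apply, tensorHomEquiv_apply_apply, homologyBasis_apply]
  obtain j | j := k
  · have hskew i := h.alt.neg_eq (hclass (loopClass (alphaLoop g j)))
      (hclass (loopClass (betaLoop g i)))
    simp [contract_tmul, sideLoop, h.alpha_alpha, ← hskew, h.alpha_beta]
  · simp [contract_tmul, sideLoop, h.alpha_beta, h.beta_beta]

end Homology

section Symbol

open PowerSeries

attribute [local instance] LieRing.ofAssociativeRing

/-- The group of the power series `1 + u X ^ (n + 1) + ⋯` over the tensor algebra whose leading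
coefficient `u` is a Lie element of degree `n + 1`. -/
def lieUnits (V : Type) [AddCommGroup V] [Module ℚ V] (n : ℕ) :
    Subgroup (TensorAlgebra ℚ V)⟦X⟧ˣ :=
  ((freeLieDeg V (n + 1)).toAddSubgroup.comap (leadingCoeff n)).toSubgroup'.map
    (principalUnits _ (n + 1)).subtype

theorem mem_lieUnits {V : Type} [AddCommGroup V] [Module ℚ V] {n : ℕ}
    {u : (TensorAlgebra ℚ V)⟦X⟧ˣ} :
    u ∈ lieUnits V n ↔ u ∈ principalUnits _ (n + 1) ∧
      coeff (n + 1) (u - 1 : (TensorAlgebra ℚ V)⟦X⟧) ∈ freeLieDeg V (n + 1) := by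
  constructor
  · rintro ⟨w, hw, rfl⟩
    exact ⟨w.2, hw⟩
  · exact fun h => ⟨⟨u, h.1⟩, h.2, rfl⟩

variable {g : ℕ}

theorem gam_succ_le_of_commutator_mem {n : ℕ} {K : Subgroup (Pi1 g)}
    (hK : ∀ x : Pi1 g, ∀ w ∈ gam g (n + 1), ⁅x, w⁆ ∈ K) : gam g (n + 2) ≤ K :=
  Subgroup.commutator_le.2 fun w hw x _ => commutatorElement_inv x w ▸ inv_mem (hK x w hw)

/-- The Magnus expansion of `π`: the side loop with homology class `h` is sent to `1 + h X`. -/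
def magnus : Pi1 g →* principalUnits (TensorAlgebra ℚ (H1 g)) 1 :=
  (pi1Basis g).lift fun j => oneAddMulX (TensorAlgebra.ι ℚ (homologyBasis g j))

theorem leadingCoeff_magnus (x : Pi1 g) :
    leadingCoeff 0 (.ofMul (magnus x)) = TensorAlgebra.ι ℚ (hclass x) := by
  let φ := (AddMonoidHom.toMultiplicativeRight (leadingCoeff 0)).comp (magnus (g := g))
  have hφ : liftHomology φ = TensorAlgebra.ι ℚ := (homologyBasis g).ext fun j => by
    have hgen : magnus (pi1Basis g j) = oneAddMulX (TensorAlgebra.ι ℚ (homologyBasis g j)) := by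
      simp [magnus]
    rw [← leadingCoeff_oneAddMulX (TensorAlgebra.ι ℚ _), ← hgen, homologyBasis_apply,
      liftHomology_hclass, ← pi1Basis_apply]
    rfl
  rw [← hφ, liftHomology_hclass]
  rfl

theorem coeff_commutator_magnus (x : Pi1 g) {n : ℕ} {u : (TensorAlgebra ℚ (H1 g))⟦X⟧ˣ}
    (hu : u ∈ principalUnits _ (n + 1)) :
    coeff (n + 2) (↑⁅(magnus x).1, u⁆ - 1 : (TensorAlgebra ℚ (H1 g))⟦X⟧) =
      ⁅TensorAlgebra.ι ℚ (hclass x), coeff (n + 1) (u - 1 : (TensorAlgebra ℚ (H1 g))⟦X⟧)⁆ := by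
  rw [← leadingCoeff_magnus, show n + 2 = 0 + 1 + (n + 1) by ring]
  exact coeff_commutator_sub_one (magnus x).2 hu

theorem commutator_magnus_mem_lieUnits (x : Pi1 g) {n : ℕ} {u : (TensorAlgebra ℚ (H1 g))⟦X⟧ˣ}
    (hu : u ∈ lieUnits (H1 g) n) : ⁅(magnus x).1, u⁆ ∈ lieUnits (H1 g) (n + 1) := by
  rw [mem_lieUnits] at hu ⊢
  refine ⟨?_, coeff_commutator_magnus x hu.1 ▸ lie_ι_mem_freeLieDeg _ hu.2⟩
  rw [show n + 1 + 1 = 1 + (n + 1) by ring]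
  exact commutator_mem_principalUnits (magnus x).2 hu.1

theorem gam_le_comap_lieUnits (n : ℕ) :
    gam g (n + 1) ≤ (lieUnits (H1 g) n).comap ((Subgroup.subtype _).comp magnus) := by
  induction n with
  | zero =>
    exact fun w _ => mem_lieUnits.2 ⟨(magnus w).2, leadingCoeff_magnus w ▸ ι_mem_freeLieDeg _⟩
  | succ n ih =>
    refine gam_succ_le_of_commutator_mem fun x w hw => ?_
    rw [Subgroup.mem_comap, map_commutatorElement]
    exact commutator_magnus_mem_lieUnits x (ih hw)

theorem magnus_mem_lieUnits {n : ℕ} (w : gam g (n + 1)) :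
    (magnus w.1).1 ∈ principalUnits _ (n + 1) ∧
      coeff (n + 1) (↑(magnus w.1).1 - 1 : (TensorAlgebra ℚ (H1 g))⟦X⟧) ∈
        freeLieDeg (H1 g) (n + 1) :=
  mem_lieUnits.1 (gam_le_comap_lieUnits n w.2)

/-- The symbol maps, given by the leading coefficients of the Magnus expansion. -/
def symbol (n : ℕ) : Additive (gam g (n + 1)) →+ freeLieDeg (H1 g) (n + 1) :=
  AddMonoidHom.codRestrict
    (AddMonoidHom.mk'
      (fun w => coeff (n + 1) (↑(magnus w.toMul.1).1 - 1 : (TensorAlgebra ℚ (H1 g))⟦X⟧))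
      fun v w => by
        rw [toMul_add, Subgroup.coe_mul, map_mul]
        exact coeff_mul_sub_one (magnus_mem_lieUnits v.toMul).1 (magnus w.toMul.1).2)
    _ fun w => (magnus_mem_lieUnits w.toMul).2

theorem isSymbol_symbol : IsSymbol g symbol where
  degree_one x := Subtype.ext (leadingCoeff_magnus x.1)
  commutator n x w := Subtype.ext <| by
    calc coeff (n + 2) (↑(magnus ⁅x, w.1⁆).1 - 1 : (TensorAlgebra ℚ (H1 g))⟦X⟧)
      _ = coeff (n + 2) (↑⁅(magnus x).1, (magnus w.1).1⁆ - 1 : (TensorAlgebra ℚ (H1 g))⟦X⟧) := by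
        rw [map_commutatorElement]
        rfl
      _ = _ := coeff_commutator_magnus x (magnus_mem_lieUnits w).1

theorem gam_addHom_ext {A : Type*} [AddGroup A] {n : ℕ} {φ ψ : Additive (gam g (n + 2)) →+ A}
    (h : ∀ (x : Pi1 g) (w : gam g (n + 1)), φ (.ofMul (commElt x w)) = ψ (.ofMul (commElt x w))) :
    φ = ψ := by
  have hle : gam g (n + 2) ≤ (φ.eqLocus ψ).toSubgroup'.map (gam g (n + 2)).subtype :=
    gam_succ_le_of_commutator_mem fun x w hw => ⟨commElt x ⟨w, hw⟩, h x ⟨w, hw⟩, rfl⟩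
  refine AddMonoidHom.ext fun w => ?_
  obtain ⟨v, hv, hvw⟩ := hle w.toMul.2
  obtain rfl : v = w.toMul := Subtype.ext hvw
  exact hv

theorem IsSymbol.unique {σ σ' : ∀ n : ℕ, Additive (gam g (n + 1)) →+ freeLieDeg (H1 g) (n + 1)}
    (h : IsSymbol g σ) (h' : IsSymbol g σ') : σ = σ' := by
  funext n
  induction n with
  | zero =>
    exact AddMonoidHom.ext fun x => (h.degree_one x.toMul).trans (h'.degree_one x.toMul).symm
  | succ n ih => exact gam_addHom_ext fun x w => by rw [h.commutator, h'.commutator, ih]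

theorem existsUnique_symbol (g : ℕ) : ∃! σ, IsSymbol g σ :=
  ⟨symbol, isSymbol_symbol, fun _ h => h.unique isSymbol_symbol⟩

end Symbol

section BoundaryWord

variable {g : ℕ}

/-- The class in `π` of the image of a path in the polygon whose endpoints are sent to the
basepoint. -/
def discClass {z w : Disc} (hz : toSurface g z = basept g) (hw : toSurface g w = basept g)
    (p : Path z w) : Pi1 g :=
  loopClass ((p.map (continuous_toSurface g)).cast hz.symm hw.symm)

theorem discClass_trans {z w v : Disc} (hz : toSurface g z = basept g)
    (hw : toSurface g w = basept g) (hv : toSurface g v = basept g) (p : Path z w) (q : Path w v) :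
    discClass hz hv (p.trans q) = discClass hw hv q * discClass hz hw p := by
  rw [FundamentalGroup.mul_def]
  simp only [discClass, loopClass, FundamentalGroup.fromPath, FundamentalGroup.fromArrow]
  rw [← Path.Homotopic.Quotient.mk_trans, ← Path.cast_trans, ← Path.map_trans]

theorem discClass_eq_one {z : Disc} (hz : toSurface g z = basept g) (p : Path z z) :
    discClass hz hz p = 1 := by
  have : ContractibleSpace Disc :=
    (convex_closedBall (0 : ℂ) 1).contractibleSpace ⟨0, Metric.mem_closedBall_self zero_le_one⟩
  have hp : p.Homotopic (Path.refl z) := SimplyConnectedSpace.paths_homotopic p _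
  refine (Path.Homotopic.Quotient.eq.mpr ((hp.map
    ⟨_, continuous_toSurface g⟩).pathCast hz.symm hz.symm)).trans ?_
  exact congrArg Path.Homotopic.Quotient.mk (Path.ext (funext fun _ => hz))

variable (g)

theorem toSurface_vertex {k : ℕ} (hk : k ≤ 4 * g) : toSurface g (sidePoint g k 0) = basept g := by
  rcases hk.eq_or_lt with rfl | hk
  · exact vertex_four_mul g g le_rfl
  obtain ⟨i, hi⟩ : ∃ i : Fin g, k = 4 * i ∨ k = 4 * i + 1 ∨ k = 4 * i + 2 ∨ k = 4 * i + 3 :=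
    ⟨⟨k / 4, by lia⟩, by simp only; lia⟩
  rcases hi with rfl | rfl | rfl | rfl
  · exact vertex_alpha_zero g i
  · exact vertex_beta_zero g i
  · rw [← vertex_beta_one g i, sidePoint_one]
  · rw [← (vertex_step g i).1, vertex_alpha_zero]

/-- Side number `k` of the polygon as a path in the disc. -/
def sidePath (k : ℕ) : Path (sidePoint g k 0) (sidePoint g (k + 1) 0) where
  toFun := sidePoint g k
  continuous_toFun := continuous_sidePoint g k
  source' := rfl
  target' := sidePoint_one g k

/-- The path along the first `k` sides of the polygon. -/
def sidesPath : ∀ k : ℕ, Path (sidePoint g 0 0) (sidePoint g k 0)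
  | 0 => Path.refl _
  | k + 1 => (sidesPath k).trans (sidePath g k)

/-- The class in `π` of the path along the first `k` sides of the polygon. -/
def sidesClass (k : ℕ) (hk : k ≤ 4 * g) : Pi1 g :=
  discClass (toSurface_vertex g (Nat.zero_le _)) (toSurface_vertex g hk) (sidesPath g k)

theorem sidesClass_zero : sidesClass g 0 (Nat.zero_le _) = 1 := discClass_eq_one _ _

theorem sidesClass_succ (k : ℕ) (hk : k + 1 ≤ 4 * g) :
    sidesClass g (k + 1) hk = discClass (toSurface_vertex g (Nat.le_of_succ_le hk))
      (toSurface_vertex g hk) (sidePath g k) * sidesClass g k (Nat.le_of_succ_le hk) :=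
  discClass_trans _ _ _ _ _

variable {g}

theorem discClass_sidePath_eq_inv {k l : ℕ} (p : Path (basept g) (basept g))
    (hp : ∀ t, p t = toSurface g (sidePoint g l t))
    (hkl : ∀ t, toSurface g (sidePoint g l t) = toSurface g (sidePoint g k (unitInterval.symm t)))
    (hz : toSurface g (sidePoint g k 0) = basept g)
    (hw : toSurface g (sidePoint g (k + 1) 0) = basept g) :
    discClass hz hw (sidePath g k) = (loopClass p)⁻¹ := by
  refine congrArg loopClass (Path.ext (funext fun t => ?_) : _ = p.symm)
  rw [Path.symm_apply, Function.comp_apply, hp, hkl, unitInterval.symm_symm]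
  rfl

theorem sidesClass_four_mul_succ (i : Fin g) :
    sidesClass g (4 * (i + 1)) (by lia) =
      ⁅(loopClass (betaLoop g i))⁻¹, (loopClass (alphaLoop g i))⁻¹⁆ *
        sidesClass g (4 * i) (by lia) := by
  refine (sidesClass_succ g (4 * i + 3) (by lia)).trans ?_
  rw [sidesClass_succ g (4 * i + 2) (by lia), sidesClass_succ g (4 * i + 1) (by lia),
    sidesClass_succ g (4 * i) (by lia),
    discClass_sidePath_eq_inv (betaLoop g i) (fun _ => rfl) fun t => Quot.sound (.beta i t),
    discClass_sidePath_eq_inv (alphaLoop g i) (fun _ => rfl) fun t => Quot.sound (.alpha i t),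
    commutatorElement_def, inv_inv, inv_inv]
  simp only [mul_assoc]
  rfl

variable (g)

/-- The free side of the polygon as a loop in the surface. -/
def boundaryLoop : Path (basept g) (basept g) where
  toFun t := toSurface g (sidePoint g (4 * g) t)
  continuous_toFun := (continuous_toSurface g).comp (continuous_sidePoint g _)
  source' := toSurface_vertex g le_rfl
  target' := by rw [sidePoint_last]; rfl

theorem loopClass_boundaryLoop_mul_sidesClass :
    loopClass (boundaryLoop g) * sidesClass g (4 * g) le_rfl = 1 := by
  have hlast : sidePoint g (4 * g + 1) 0 = sidePoint g 0 0 := by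
    rw [← sidePoint_one, sidePoint_last]
  have hv : toSurface g (sidePoint g (4 * g + 1) 0) = basept g := by rw [hlast]; rfl
  exact (discClass_trans (toSurface_vertex g (Nat.zero_le _)) (toSurface_vertex g le_rfl) hv
    (sidesPath g (4 * g)) (sidePath g (4 * g))).symm.trans
      (discClass_eq_one (z := sidePoint g 0 0) rfl
        (((sidesPath g (4 * g)).trans (sidePath g (4 * g))).cast rfl hlast.symm))

/-- The product of commutators representing the boundary of the surface. The inverses appear
because the product `x * y` in `FundamentalGroup` is the class of the loop `y` followed by `x`. -/
def boundaryWord : Pi1 g :=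
  (List.ofFn fun i => ⁅(loopClass (alphaLoop g i))⁻¹, (loopClass (betaLoop g i))⁻¹⁆).prod

theorem sidesClass_four_mul_mul_prod (k : ℕ) (hk : k ≤ g) :
    sidesClass g (4 * k) (by lia) * (List.ofFn fun i : Fin k =>
      ⁅(loopClass (alphaLoop g (i.castLE hk)))⁻¹, (loopClass (betaLoop g (i.castLE hk)))⁻¹⁆).prod =
        1 := by
  induction k with
  | zero => rw [List.ofFn_zero, List.prod_nil, mul_one, sidesClass_zero]
  | succ k ih =>
    rw [List.ofFn_succ', List.concat_eq_append, List.prod_append, List.prod_singleton,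
      sidesClass_four_mul_succ ⟨k, hk⟩, mul_assoc, ← mul_assoc (sidesClass _ _ _),
      mul_eq_one_iff_inv_eq, commutatorElement_inv]
    exact (mul_eq_right.2 (ih (Nat.le_of_succ_le hk))).symm

theorem loopClass_boundaryLoop : loopClass (boundaryLoop g) = boundaryWord g :=
  (eq_inv_of_mul_eq_one_left (loopClass_boundaryLoop_mul_sidesClass g)).trans
    (inv_eq_of_mul_eq_one_right (sidesClass_four_mul_mul_prod g g le_rfl))

variable {g}

theorem mcgAction_boundaryWord (f : MCG g) : mcgAction g f (boundaryWord g) = boundaryWord g := by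
  induction f using QuotientGroup.induction_on with | H f =>
  rw [← loopClass_boundaryLoop]
  exact (inducedHom_loopClass f _).trans
    (congrArg loopClass (Path.ext (funext fun t => f.2 _ ⟨t, rfl⟩)))

end BoundaryWord

section JohnsonHom

variable {g : ℕ} {σ : ∀ n : ℕ, Additive (gam g (n + 1)) →+ freeLieDeg (H1 g) (n + 1)}

theorem hclass_eq_zero_of_mem_gam_two {x : Pi1 g} (hx : x ∈ gam g 2) : hclass x = 0 := by
  have h : x ∈ (Abelianization.of (G := Pi1 g)).ker := by rwa [Abelianization.ker_of]
  rw [hclass, MonoidHom.mem_ker.1 h, ofMul_one, TensorProduct.tmul_zero]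

theorem gam_antitone (g : ℕ) : Antitone (gam g) :=
  fun _ _ h => Subgroup.lowerCentralSeries_antitone _ (Nat.sub_le_sub_right h 1)

theorem hclass_eq_of_mem_gam_two {x y : Pi1 g} (h : x * y⁻¹ ∈ gam g 2) : hclass x = hclass y := by
  rw [← inv_mul_cancel_right x y, hclass_mul, hclass_eq_zero_of_mem_gam_two h, zero_add]

theorem IsSymbol.apply_inclusion (h : IsSymbol g σ) (n : ℕ) (w : gam g (n + 2)) :
    σ n (.ofMul (Subgroup.inclusion (gam_antitone g (Nat.le_succ (n + 1))) w)) = 0 := by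
  induction n with
  | zero =>
    exact (h.degree_one _).trans
      ((congrArg _ (hclass_eq_zero_of_mem_gam_two w.2)).trans (map_zero _))
  | succ n ih =>
    refine DFunLike.congr_fun (gam_addHom_ext (φ := (σ (n + 1)).comp (MonoidHom.toAdditive
      (Subgroup.inclusion (gam_antitone g (Nat.le_succ (n + 2)))))) (ψ := 0) fun x w => ?_)
      (.ofMul w)
    have hw := h.commutator n x (Subgroup.inclusion (gam_antitone g (Nat.le_succ (n + 1))) w)
    rwa [ih, map_zero] at hw

theorem IsSymbol.apply_conj (h : IsSymbol g σ) {n : ℕ} (x : Pi1 g) (w : gam g (n + 1)) :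
    σ n (.ofMul ⟨x * w * x⁻¹, Subgroup.Normal.conj_mem inferInstance _ w.2 x⟩) =
      σ n (.ofMul w) := by
  have hconj : (⟨x * w * x⁻¹, Subgroup.Normal.conj_mem inferInstance _ w.2 x⟩ : gam g (n + 1)) =
      Subgroup.inclusion (gam_antitone g (Nat.le_succ (n + 1))) (commElt x w) * w :=
    Subtype.ext (inv_mul_cancel_right _ _).symm
  rw [hconj, ofMul_mul, map_add, h.apply_inclusion, zero_add]

theorem map_mem_gam (φ : Pi1 g →* Pi1 g) {n : ℕ} {w : Pi1 g} (hw : w ∈ gam g n) :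
    φ w ∈ gam g n := by
  have hmap : φ w ∈ (gam g n).map φ := Subgroup.mem_map_of_mem φ hw
  rw [Subgroup.map_lowerCentralSeries] at hmap
  exact Subgroup.lowerCentralSeries_mono _ le_top hmap

theorem IsSymbol.apply_map (h : IsSymbol g σ) {φ : Pi1 g →* Pi1 g}
    (hφ : ∀ x, hclass (φ x) = hclass x) {n : ℕ} (w : gam g (n + 1)) :
    σ n (.ofMul ⟨φ w, map_mem_gam φ w.2⟩) = σ n (.ofMul w) := by
  let σφ (n : ℕ) : Additive (gam g (n + 1)) →+ freeLieDeg (H1 g) (n + 1) :=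
    (σ n).comp (MonoidHom.toAdditive ((φ.comp (gam g (n + 1)).subtype).codRestrict (gam g (n + 1))
      fun w => map_mem_gam φ w.2))
  have hσφ : IsSymbol g σφ := {
    degree_one := fun x => (h.degree_one _).trans (congrArg _ (hφ x))
    commutator := fun n x w => by
      have hcomm := h.commutator n (φ x) ⟨φ w, map_mem_gam φ w.2⟩
      rw [hφ] at hcomm
      exact (congrArg (fun v => σ (n + 1) (.ofMul v))
        (Subtype.ext (map_commutatorElement φ x w))).trans hcomm }
  exact DFunLike.congr_fun (congrFun (hσφ.unique h) n) (.ofMul w)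

/-- The subgroup of the `w ∈ π` that an endomorphism of `π` moves by an element of
`γ_{n+1}(π)`. -/
def movedBy (φ : Pi1 g →* Pi1 g) (n : ℕ) : Subgroup (Pi1 g) :=
  ((QuotientGroup.mk' (gam g (n + 1))).comp φ).eqLocus (QuotientGroup.mk' (gam g (n + 1)))

theorem mem_movedBy {φ : Pi1 g →* Pi1 g} {n : ℕ} {w : Pi1 g} :
    w ∈ movedBy φ n ↔ φ w * w⁻¹ ∈ gam g (n + 1) := by
  rw [← div_eq_mul_inv]
  exact QuotientGroup.eq_iff_div_mem

/-- The homomorphism `w ↦ ⟦φ(w) w⁻¹⟧_{n+1}`. -/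
def IsSymbol.displacement (h : IsSymbol g σ) (φ : Pi1 g →* Pi1 g) (n : ℕ) :
    movedBy φ n →* Multiplicative (freeLieDeg (H1 g) (n + 1)) :=
  MonoidHom.mk' (fun w => .ofAdd (σ n (.ofMul ⟨φ w * w⁻¹, mem_movedBy.1 w.2⟩))) fun v w => by
    rw [← ofAdd_add, ← h.apply_conj v ⟨φ w * w⁻¹, mem_movedBy.1 w.2⟩, ← map_add, ← ofMul_mul]
    congr 3
    exact Subtype.ext (by push_cast; rw [_root_.map_mul]; group)

variable {φ : Pi1 g →* Pi1 g} {d : ℕ}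

theorem IsSymbol.displacement_eq_zero (h : IsSymbol g σ) {w : movedBy φ d} (hw : φ w = w) :
    (h.displacement φ d w).toAdd = 0 :=
  (congrArg (fun v => σ d (.ofMul v)) (Subtype.ext (mul_inv_eq_one.2 hw))).trans (map_zero _)

theorem map_commutator_mul_inv (hφ : ∀ x, φ x * x⁻¹ ∈ gam g (d + 1)) (x y : Pi1 g) :
    φ ⁅x, y⁆ * ⁅x, y⁆⁻¹ =
      ((commElt ⁅x, φ y⁆ ⟨_, hφ x⟩)⁻¹ *
        ⟨⁅x, φ y⁆ * ↑(commElt (φ y) ⟨_, hφ x⟩)⁻¹ * ⁅x, φ y⁆⁻¹,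
          Subgroup.Normal.conj_mem inferInstance _ (Subtype.prop _) _⟩ *
        commElt x ⟨_, hφ y⟩ * (commElt ⁅x, y⁆ ⟨_, hφ y⟩)⁻¹ : gam g (d + 2)) := by
  simp only [commElt, Subgroup.coe_mul, Subgroup.coe_inv, commutatorElement_def, map_mul, map_inv]
  group

theorem commutator_mem_movedBy (hφ : ∀ x, φ x * x⁻¹ ∈ gam g (d + 1)) (x y : Pi1 g) :
    ⁅x, y⁆ ∈ movedBy φ (d + 1) := by
  rw [mem_movedBy, map_commutator_mul_inv hφ]
  exact Subtype.prop _

theorem hclass_commutator (x y : Pi1 g) : hclass ⁅x, y⁆ = 0 :=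
  hclass_eq_zero_of_mem_gam_two
    (Subgroup.commutator_mem_commutator (Subgroup.mem_top x) (Subgroup.mem_top y))

/-- For an endomorphism `φ` of `π` that is the identity modulo `γ_{d+1}(π)`, the linear map on
`H` induced by `x ↦ ⟦φ(x) x⁻¹⟧_{d+1}`. -/
def IsSymbol.johnsonMap (h : IsSymbol g σ) (hφ : ∀ x, φ x * x⁻¹ ∈ gam g (d + 1)) :
    H1 g →ₗ[ℚ] freeLieDeg (H1 g) (d + 1) :=
  liftHomology ((h.displacement φ d).comp
    ((MonoidHom.id (Pi1 g)).codRestrict (movedBy φ d) fun x => mem_movedBy.2 (hφ x)))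

theorem IsSymbol.johnsonMap_hclass (h : IsSymbol g σ) (hφ : ∀ x, φ x * x⁻¹ ∈ gam g (d + 1))
    (x : Pi1 g) : h.johnsonMap hφ (hclass x) = σ d (.ofMul ⟨_, hφ x⟩) :=
  liftHomology_hclass _ x

theorem IsSymbol.displacement_commutator (h : IsSymbol g σ)
    (hφ : ∀ x, φ x * x⁻¹ ∈ gam g (d + 1)) (hφH : ∀ x, hclass (φ x) = hclass x) (x y : Pi1 g) :
    (h.displacement φ (d + 1) ⟨⁅x, y⁆, commutator_mem_movedBy hφ x y⟩).toAdd =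
      lieGen (H1 g) (d + 1) (hclass x) (h.johnsonMap hφ (hclass y)) -
        lieGen (H1 g) (d + 1) (hclass y) (h.johnsonMap hφ (hclass x)) := by
  refine (congrArg (fun w => σ (d + 1) (.ofMul w))
    (Subtype.ext (map_commutator_mul_inv hφ x y))).trans ?_
  simp only [ofMul_mul, ofMul_inv, map_add, map_neg, h.apply_conj, h.commutator,
    hclass_commutator, h.johnsonMap_hclass, map_zero, LinearMap.zero_apply, hφH,
    neg_zero, zero_add, add_zero]
  abel

theorem IsSymbol.sum_lieGen_johnsonMap_eq_zero (h : IsSymbol g σ)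
    (hφ : ∀ x, φ x * x⁻¹ ∈ gam g (d + 1)) (hφH : ∀ x, hclass (φ x) = hclass x)
    (hfix : φ (boundaryWord g) = boundaryWord g) :
    ∑ i, (lieGen (H1 g) (d + 1) (hclass (loopClass (alphaLoop g i)))
        (h.johnsonMap hφ (hclass (loopClass (betaLoop g i)))) -
      lieGen (H1 g) (d + 1) (hclass (loopClass (betaLoop g i)))
        (h.johnsonMap hφ (hclass (loopClass (alphaLoop g i))))) = 0 := by
  let c (i : Fin g) : movedBy φ (d + 1) := ⟨_, commutator_mem_movedBy hφ
    (loopClass (alphaLoop g i))⁻¹ (loopClass (betaLoop g i))⁻¹⟩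
  have hc : ((List.ofFn c).prod : Pi1 g) = boundaryWord g := by
    rw [SubmonoidClass.coe_list_prod, List.map_ofFn]
    rfl
  have hzero : (h.displacement φ (d + 1) (List.ofFn c).prod).toAdd = 0 := by
    refine h.displacement_eq_zero ?_
    rw [hc, hfix]
  rw [map_list_prod, List.map_ofFn, List.prod_ofFn, toAdd_prod] at hzero
  rw [← hzero]
  refine Finset.sum_congr rfl fun i _ => ?_
  rw [Function.comp_apply, h.displacement_commutator hφ hφH]
  simp only [hclass_inv, map_neg, LinearMap.neg_apply, neg_neg]

theorem leftDiff_mul (f f' : johnsonFiltration g d) (x : Pi1 g) :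
    leftDiff (f * f') x =
      ⟨(mcgAction g f.1).toMonoidHom (leftDiff f' x), map_mem_gam _ (leftDiff f' x).2⟩ *
        leftDiff f x := by
  refine Subtype.ext ?_
  simp only [leftDiff, Subgroup.coe_mul, map_mul, MulAut.mul_apply, MulEquiv.toMonoidHom_eq_coe,
    MonoidHom.coe_coe, map_inv]
  group

theorem mcgAction_mul_inv_mem (f : johnsonFiltration g d) (x : Pi1 g) :
    (mcgAction g f.1).toMonoidHom x * x⁻¹ ∈ gam g (d + 1) :=
  (leftDiff f x).2

theorem hclass_mcgAction (hd : 1 ≤ d) (f : johnsonFiltration g d) (x : Pi1 g) :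
    hclass ((mcgAction g f.1).toMonoidHom x) = hclass x :=
  hclass_eq_of_mem_gam_two (gam_antitone g (Nat.succ_le_succ hd) (mcgAction_mul_inv_mem f x))

/-- The element of `Hom(H, L_{d+1}(H))` corresponding to the value `τ_d(f)` of the Johnson
homomorphism. -/
def IsSymbol.johnsonValue (h : IsSymbol g σ) (f : johnsonFiltration g d) :
    H1 g →ₗ[ℚ] freeLieDeg (H1 g) (d + 1) :=
  h.johnsonMap (mcgAction_mul_inv_mem f)

theorem IsSymbol.johnsonValue_hclass (h : IsSymbol g σ) (f : johnsonFiltration g d) (x : Pi1 g) :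
    h.johnsonValue f (hclass x) = σ d (.ofMul (leftDiff f x)) :=
  h.johnsonMap_hclass _ x

theorem linearMap_H1_ext {M : Type*} [AddCommGroup M] [Module ℚ M] {u v : H1 g →ₗ[ℚ] M}
    (huv : ∀ x, u (hclass x) = v (hclass x)) : u = v :=
  (homologyBasis g).ext fun j => by rw [homologyBasis_apply, huv]

theorem IsSymbol.johnsonValue_mul (h : IsSymbol g σ) (hd : 1 ≤ d) (f f' : johnsonFiltration g d) :
    h.johnsonValue (f * f') = h.johnsonValue f + h.johnsonValue f' := by
  refine linearMap_H1_ext fun x => ?_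
  rw [LinearMap.add_apply, h.johnsonValue_hclass, h.johnsonValue_hclass, h.johnsonValue_hclass,
    leftDiff_mul, ofMul_mul, map_add, h.apply_map (hclass_mcgAction hd f)]
  exact add_comm _ _

theorem IsSymbol.isJohnsonHom_iff (h : IsSymbol g σ) {ω : LinearMap.BilinForm ℚ (H1 g)}
    (hω : ω.Nondegenerate)
    {τ : Additive (johnsonFiltration g d) →+ H1 g ⊗[ℚ] freeLieDeg (H1 g) (d + 1)} :
    IsJohnsonHom g d ω σ τ ↔ ∀ f, tensorHomEquiv ω hω (τ f) = h.johnsonValue f.toMul := by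
  refine forall_congr' fun f => ⟨fun hf => linearMap_H1_ext fun x => ?_, fun hf x => ?_⟩
  · rw [tensorHomEquiv_apply_apply, h.johnsonValue_hclass]
    exact hf x
  · rw [← h.johnsonValue_hclass, ← tensorHomEquiv_apply_apply ω hω]
    exact congrArg (· (hclass x)) hf

theorem existsUnique_johnsonHom (hd : 1 ≤ d) (h : IsSymbol g σ)
    {ω : LinearMap.BilinForm ℚ (H1 g)} (hω : ω.Nondegenerate) : ∃! τ, IsJohnsonHom g d ω σ τ := by
  simp only [h.isJohnsonHom_iff hω, ← LinearEquiv.eq_symm_apply]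
  exact ⟨(tensorHomEquiv ω hω).symm.toAddMonoidHom.comp
    (AddMonoidHom.mk' (fun f => h.johnsonValue f.toMul) fun f f' => h.johnsonValue_mul hd _ _),
    fun f => rfl, fun τ hτ => AddMonoidHom.ext hτ⟩

theorem IsJohnsonHom.lieBracketMap_eq_zero (hd : 1 ≤ d) (h : IsSymbol g σ)
    {ω : LinearMap.BilinForm ℚ (H1 g)} (hω : IsIntersectionForm g ω)
    {τ : Additive (johnsonFiltration g d) →+ H1 g ⊗[ℚ] freeLieDeg (H1 g) (d + 1)}
    (hτ : IsJohnsonHom g d ω σ τ) (f : Additive (johnsonFiltration g d)) :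
    lieBracketMap (H1 g) (d + 1) (τ f) = 0 := by
  have hcontract (x : Pi1 g) :
      contract ω (hclass x) (τ f) = h.johnsonMap (mcgAction_mul_inv_mem f.toMul) (hclass x) :=
    (hτ f.toMul x).trans (h.johnsonValue_hclass f.toMul x).symm
  rw [← hω.sum_tmul_contract (τ f), map_sum,
    ← h.sum_lieGen_johnsonMap_eq_zero (mcgAction_mul_inv_mem f.toMul)
      (hclass_mcgAction hd f.toMul) (mcgAction_boundaryWord f.toMul.1)]
  refine Finset.sum_congr rfl fun i _ => ?_
  rw [map_sub, lieBracketMap, TensorProduct.lift.tmul, TensorProduct.lift.tmul, hcontract,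
    hcontract]

end JohnsonHom

end

end Johnson

theorem mainTheorem5 (g d : ℕ) (hg : 1 ≤ g) (hd : 1 ≤ d) :
    (∃! ω, Johnson.IsIntersectionForm g ω) ∧
    (∃! σ, Johnson.IsSymbol g σ) ∧
    ∀ ω σ, Johnson.IsIntersectionForm g ω → Johnson.IsSymbol g σ →
      (∃! τ, Johnson.IsJohnsonHom g d ω σ τ) ∧
      ∀ τ, Johnson.IsJohnsonHom g d ω σ τ →
        τ.range ≤ (LinearMap.ker
          (Johnson.lieBracketMap (Johnson.H1 g) (d + 1))).toAddSubgroup := by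
  refine ⟨Johnson.existsUnique_intersectionForm g, Johnson.existsUnique_symbol g,
    fun ω σ hω hσ => ⟨Johnson.existsUnique_johnsonHom hd hσ hω.nondegenerate, ?_⟩⟩
  rintro τ hτ _ ⟨f, rfl⟩
  exact hτ.lieBracketMap_eq_zero hd hσ hω f
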